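/- Let $\mathfrak S_2=\{(z_1,z_2)\in\mathbb C^2: z_1+\overline{z_1}>|z_2|^2\}$ be the Siegel domain, with boundary $\partial\mathfrak S_2=\{(w_1,w_2)\in\mathbb C^2: w_1+\overline{w_1}=|w_2|^2\}$, and let $dm(W)=dm(w)\,dv$ be Lebesgue measure on $\partial\mathfrak S_2$ in the coordinates $W=(\tfrac12|w|^2+iv,\,w)$, $w\in\mathbb C$, $v\in\mathbb R$. For $Z=(z_1,z_2)$ and $W=(w_1,w_2)$ put $$\rho(Z,W)=\overline{z_1}+w_1-\overline{z_2}\,w_2,\qquad \rho(Z)=\rho(Z,Z),$$ $$P(Z,W)=\frac{\rho(Z)}{|\rho(Z,W)|^2}\quad(Z\in\mathfrak S_2,\ W\in\partial\mathfrak S_2),\qquad \sigma(Z,Z')=\frac{|\rho(Z,Z')|^2}{\rho(Z)\rho(Z')},\qquad u=u(Z,Z')=\sigma(Z,Z')-1 .$$ Let $F={}_2F_1$ be the Gauss hypergeometric function, on its principal branch in $\mathbb C\setminus[1,\infty)$. **Theorem.** Let $Z\neq Z'$ be points of $\mathfrak S_2$. For every $s\in\mathbb C$ the integral $$\phi(Z,Z';s)=\int_{\partial\mathfrak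 S_2}P(Z,W)^s\,P(Z',W)^{2-s}\,dm(W)$$ converges absolutely. For $s\in\mathbb C$ with $2s\notin\mathbb Z$ one has $$\phi(Z,Z';s)=T(s)+T(2-s),\qquad T(s)=-\frac{\pi}{s-1}\,\frac{\sqrt\pi\,\Gamma(\frac32-s)}{\Gamma(2-s)}\Big(\frac14\Big)^{s-1}u^{-s}\,F(s,s-1;2s-1;-u^{-1}),$$ and also $$\phi(Z,Z';s)=-\frac{\pi}{s-1}\,c(s)\,c(2-s)\,\big[r(Z,Z';s)-r(Z,Z';2-s)\big],$$ where $$c(s)=\frac{\sqrt\pi\,\Gamma(s-\frac12)}{\Gamma(s)},\qquad r(Z,Z';s)=\frac{\Gamma(s)}{\sqrt\pi\,\Gamma(s-\frac12)}\Big(\frac14\Big)^{s-1}u^{-s}\,F(s,s-1;2s-1;-u^{-1}).$$ At every point $s_0\in\mathbb C$, in particular at those with $2s_0\in\mathbb Z$, one has $T(s)+T(2-s)\to\phi(Z,Z';s_0)$ as $s\to s_0$, $s\neq s_0$; so the formula holds at the excluded points in the sense of limits. -/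

import Mathlib

open MeasureTheory Filter Topology

namespace Siegel

/-- The Siegel domain `𝔖₂ = {(z₁, z₂) ∈ ℂ² : z₁ + conj z₁ > |z₂|²}`. -/
def domain : Set (ℂ × ℂ) := {Z | ‖Z.2‖ ^ 2 < 2 * Z.1.re}

/-- The boundary `∂𝔖₂ = {(w₁, w₂) ∈ ℂ² : w₁ + conj w₁ = |w₂|²}`. -/
def boundary : Set (ℂ × ℂ) := {W | 2 * W.1.re = ‖W.2‖ ^ 2}

/-- `ρ(Z, W) = conj z₁ + w₁ - conj z₂ * w₂`. -/
noncomputable def rho (Z W : ℂ × ℂ) : ℂ :=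
  starRingEnd ℂ Z.1 + W.1 - starRingEnd ℂ Z.2 * W.2

/-- `ρ(Z) = ρ(Z, Z)`, which is a real number (see `rho_self`). -/
noncomputable def height (Z : ℂ × ℂ) : ℝ := (rho Z Z).re

theorem rho_self (Z : ℂ × ℂ) : rho Z Z = (height Z : ℂ) := by
  apply Complex.ext
  · simp [rho, height]
  · simp [rho, height]; ring

/-- The Poisson kernel `P(Z, W) = ρ(Z) / |ρ(Z, W)|²`. -/
noncomputable def poisson (Z W : ℂ × ℂ) : ℝ := height Z / ‖rho Z W‖ ^ 2

/-- The point-pair invariant `σ(Z, Z') = |ρ(Z, Z')|² / (ρ(Z) ρ(Z'))`. -/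
noncomputable def sigma (Z Z' : ℂ × ℂ) : ℝ := ‖rho Z Z'‖ ^ 2 / (height Z * height Z')

/-- The point-pair invariant `u(Z, Z') = σ(Z, Z') - 1`. -/
noncomputable def u (Z Z' : ℂ × ℂ) : ℝ := sigma Z Z' - 1

/-- The global coordinates `(w, v) ↦ (|w|²/2 + i v, w)` of the boundary. -/
noncomputable def boundaryPoint (p : ℂ × ℝ) : boundary :=
  ⟨(((‖p.1‖ ^ 2 / 2 : ℝ) : ℂ) + (p.2 : ℂ) * Complex.I, p.1), by
    simp only [boundary, Set.mem_ofPred_eq, Complex.add_re, Complex.ofReal_re, Complex.mul_re,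
      Complex.I_re, Complex.ofReal_im, Complex.I_im]
    ring⟩

/-- The Lebesgue measure `dm(W) = dm(w) dv` on the boundary, in the coordinates
`W = (|w|²/2 + i v, w)`, `w ∈ ℂ`, `v ∈ ℝ`. -/
noncomputable def boundaryMeasure : Measure boundary :=
  (volume : Measure (ℂ × ℝ)).map boundaryPoint

/-- The integrand `P(Z, W)^s P(Z', W)^(2-s)`. -/
noncomputable def phiIntegrand (Z Z' : ℂ × ℂ) (s : ℂ) (W : boundary) : ℂ :=
  (poisson Z W : ℂ) ^ s * (poisson Z' W : ℂ) ^ (2 - s)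

/-- `φ(Z, Z'; s) = ∫_{∂𝔖₂} P(Z, W)^s P(Z', W)^(2-s) dm(W)`. -/
noncomputable def phi (Z Z' : ℂ × ℂ) (s : ℂ) : ℂ :=
  ∫ W, phiIntegrand Z Z' s W ∂boundaryMeasure

open Classical in
/-- The principal branch of the Gauss hypergeometric function `F(a, b; c; z)`: the value at `z` of
the analytic continuation, along the segment from `0` to `z`, of the germ at `0` defined by the
hypergeometric series. (For `z` in the star-shaped domain `ℂ ∖ [1, ∞)` this continuation exists.)
The value does not depend on the choice made, see `hypF_eq`. -/
noncomputable def hypF (a b c z : ℂ) : ℂ :=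
  if h : ∃ f : ℂ → ℂ, AnalyticOnNhd ℂ f (segment ℝ 0 z) ∧ f =ᶠ[𝓝 0] ordinaryHypergeometric a b c
  then h.choose z else 0

theorem hypF_eq {a b c z : ℂ} {f : ℂ → ℂ} (hf : AnalyticOnNhd ℂ f (segment ℝ 0 z))
    (h0 : f =ᶠ[𝓝 0] ordinaryHypergeometric a b c) : hypF a b c z = f z := by
  have h : ∃ f : ℂ → ℂ, AnalyticOnNhd ℂ f (segment ℝ 0 z) ∧
      f =ᶠ[𝓝 0] ordinaryHypergeometric a b c := ⟨f, hf, h0⟩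
  rw [hypF, dif_pos h]
  exact h.choose_spec.1.eqOn_of_preconnected_of_eventuallyEq hf
    (convex_segment (0 : ℂ) z).isPreconnected (left_mem_segment ℝ 0 z)
    (h.choose_spec.2.trans h0.symm) (right_mem_segment ℝ 0 z)

/-- The term
`-π/(s-1) · √π Γ(3/2-s)/Γ(2-s) · (1/4)^(s-1) · u^(-s) · F(s, s-1; 2s-1; -1/u)`. -/
noncomputable def term (u : ℝ) (s : ℂ) : ℂ :=
  -((Real.pi : ℂ) / (s - 1)) *
    ((Real.sqrt Real.pi : ℂ) * Complex.Gamma (3 / 2 - s) / Complex.Gamma (2 - s)) *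
    (1 / 4 : ℂ) ^ (s - 1) * (u : ℂ) ^ (-s) * hypF s (s - 1) (2 * s - 1) (-(u : ℂ)⁻¹)

/-- `c(s) = √π Γ(s-1/2) / Γ(s)`. -/
noncomputable def cFun (s : ℂ) : ℂ :=
  (Real.sqrt Real.pi : ℂ) * Complex.Gamma (s - 1 / 2) / Complex.Gamma s

/-- The Green function
`r(Z, Z'; s) = Γ(s)/(√π Γ(s-1/2)) · (1/4)^(s-1) · u^(-s) · F(s, s-1; 2s-1; -1/u)`,
with `u = u(Z, Z')`. -/
noncomputable def green (Z Z' : ℂ × ℂ) (s : ℂ) : ℂ :=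
  Complex.Gamma s / ((Real.sqrt Real.pi : ℂ) * Complex.Gamma (s - 1 / 2)) *
    (1 / 4 : ℂ) ^ (s - 1) * (u Z Z' : ℂ) ^ (-s) *
    hypF s (s - 1) (2 * s - 1) (-(u Z Z' : ℂ)⁻¹)

end Siegel

/-! Everything rests on one closed form: φ = 2π² ξ^s F(s, s; 2; 1 - ξ) with ξ = 1/σ(Z, Z'). A
Heisenberg translation, polar coordinates in w and a Cayley transform adapted to Z' turn the
boundary, up to null sets, into the unit sphere of ℂ² with points (ζ, √(1 - |ζ|²) e^(iθ)), and P(Z',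
W)² dm(W) into its invariant measure dζ dθ, of mass 2π². The quotient P(Z, W) / P(Z', W) becomes ξ
|1 - y|⁻², where y is, up to a ζ-dependent rotation of θ, a linear form of squared norm 1 - ξ < 1.
The integrand is therefore bounded, which gives absolute convergence for every s. Distinct powers of
y are orthogonal and ∫ |y|^(2n) = 2π² (1 - ξ)^n / (n + 1), so expanding the binomials gives the
hypergeometric series (`integral_binomial_linearForm`, `phi_eq_hypergeometric`).

The two terms T come from the connection formula between ξ = 1 and ξ = 0 (`connection`). Three
solutions of a second order equation are related through their Wronskians, which are constant after
normalisation. One coefficient is found by letting ξ → 0+ for real s in (0, 1/2), by Abel's limit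
theorem and Gauss's sum, and is continued in s by the identity theorem. The other follows from the
symmetry s ↦ 2 - s, which is Euler's transformation. Pfaff's transformation and the duplication
formula then identify the two solutions at ξ = 0 with T(s) and T(2 - s) (`term_eq`).

The closed form is continuous in s everywhere, so the limits at half-integers follow. -/

namespace Hypergeometric

/-! ### Hypergeometric series: differential equation, Pfaff and Euler transformations -/

/-- The coefficients of the Gauss hypergeometric series. -/
noncomputable def coeff (a b c : ℂ) (n : ℕ) : ℂ := ordinaryHypergeometricCoefficient a b c n

/-- The Gauss hypergeometric function on the unit disc. -/
local notation "F" => ordinaryHypergeometric (𝕂 := ℂ) (𝔸 := ℂ)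

theorem coefficient_zero (a b c : ℂ) : coeff a b c 0 = 1 := by
  simp [coeff, ordinaryHypergeometricCoefficient]

theorem ascPochhammer_eval_ne_zero {c : ℂ} (hc : ∀ k : ℕ, c ≠ -k) (n : ℕ) :
    (ascPochhammer ℂ n).eval c ≠ 0 := by
  rw [Ne, ascPochhammer_eval_eq_zero_iff]
  rintro ⟨k, -, hk⟩
  exact hc k (by rw [hk, neg_neg])

theorem coefficient_succ {a b c : ℂ} (hc : ∀ k : ℕ, c ≠ -k) (n : ℕ) :
    coeff a b c (n + 1) = (a + n) * (b + n) / ((c + n) * (n + 1)) * coeff a b c n := by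
  have h1 := ascPochhammer_eval_ne_zero hc n
  have h2 : c + n ≠ 0 := fun h => hc n (eq_neg_of_add_eq_zero_left h)
  have h3 : (n : ℂ) + 1 ≠ 0 := Nat.cast_add_one_ne_zero n
  have h4 : (n.factorial : ℂ) ≠ 0 := Nat.cast_ne_zero.2 n.factorial_ne_zero
  simp only [coeff, ordinaryHypergeometricCoefficient, ascPochhammer_succ_eval, Nat.factorial_succ,
    Nat.cast_mul, Nat.cast_add, Nat.cast_one]
  field_simp

/-- No condition on c is needed: (c)_(n+1) = c (c+1)_n, and this factorisation survives inversion
because the inverse of 0 is 0. -/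
theorem succ_mul_coefficient_succ (a b c : ℂ) (n : ℕ) :
    ((n : ℂ) + 1) * coeff a b c (n + 1) = a * b / c * coeff (a + 1) (b + 1) (c + 1) n := by
  have h3 : (n : ℂ) + 1 ≠ 0 := Nat.cast_add_one_ne_zero n
  have h4 : (n.factorial : ℂ) ≠ 0 := Nat.cast_ne_zero.2 n.factorial_ne_zero
  simp only [coeff, ordinaryHypergeometricCoefficient, ascPochhammer_succ_left, Nat.factorial_succ,
    Nat.cast_mul, Nat.cast_add, Nat.cast_one, Polynomial.eval_mul, Polynomial.eval_X,
    Polynomial.eval_comp, Polynomial.eval_add, Polynomial.eval_one, mul_inv]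
  field_simp

/-- When a parameter is a nonpositive integer the coefficients eventually vanish (for c because 1/0
= 0), so the radius is infinite; otherwise it is 1. -/
theorem one_le_radius (a b c : ℂ) : 1 ≤ (ordinaryHypergeometricSeries ℂ a b c).radius := by
  by_cases h : ∀ k : ℕ, (k : ℂ) ≠ -a ∧ (k : ℂ) ≠ -b ∧ (k : ℂ) ≠ -c
  · rw [ordinaryHypergeometricSeries_radius_eq_one ℂ a b c h]
  · push Not at h
    obtain ⟨k, hk⟩ := h
    have : (k : ℂ) = -a ∨ (k : ℂ) = -b ∨ (k : ℂ) = -c := by tauto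
    have h0 : (ordinaryHypergeometricSeries ℂ a b c).radius = ⊤ :=
      FormalMultilinearSeries.radius_eq_top_of_forall_image_add_eq_zero _ (1 + k) fun n =>
        ordinaryHypergeometricSeries_eq_zero_of_neg_nat a b c this (by omega)
    simp [h0]

theorem hasFPowerSeriesOnBall (a b c : ℂ) :
    HasFPowerSeriesOnBall (F a b c) (ordinaryHypergeometricSeries ℂ a b c) 0 1 :=
  ((ordinaryHypergeometricSeries ℂ a b c).hasFPowerSeriesOnBall
    (zero_lt_one.trans_le (one_le_radius a b c))).mono one_pos (one_le_radius a b c)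

theorem mem_eball_zero_one {z : ℂ} : z ∈ Metric.eball (0 : ℂ) 1 ↔ ‖z‖ < 1 := by
  rw [← ENNReal.ofReal_one, Metric.eball_ofReal, mem_ball_zero_iff]

theorem analyticAt (a b c : ℂ) {z : ℂ} (hz : ‖z‖ < 1) : AnalyticAt ℂ (F a b c) z :=
  (hasFPowerSeriesOnBall a b c).analyticAt_of_mem (mem_eball_zero_one.2 hz)

theorem hasSum (a b c : ℂ) {z : ℂ} (hz : ‖z‖ < 1) :
    HasSum (fun n => coeff a b c n * z ^ n) (F a b c z) := by
  have := (hasFPowerSeriesOnBall a b c).hasSum (mem_eball_zero_one.2 hz)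
  simp only [ordinaryHypergeometricSeries, FormalMultilinearSeries.ofScalars_apply_eq, zero_add,
    smul_eq_mul] at this
  exact this

theorem hasDerivAt (a b c : ℂ) {z : ℂ} (hz : ‖z‖ < 1) :
    HasDerivAt (F a b c) (a * b / c * F (a + 1) (b + 1) (c + 1) z) z := by
  have h1 := ((hasFPowerSeriesOnBall a b c).fderiv.hasSum (mem_eball_zero_one.2 hz)).mapL
    (ContinuousLinearMap.apply ℂ ℂ (1 : ℂ))
  have h2 : ∀ n : ℕ, (ContinuousLinearMap.apply ℂ ℂ (1 : ℂ))
      ((ordinaryHypergeometricSeries ℂ a b c).derivSeries n fun _ => z) =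
      a * b / c * (coeff (a + 1) (b + 1) (c + 1) n * z ^ n) := by
    intro n
    rw [← mul_assoc, ← succ_mul_coefficient_succ]
    have := (ordinaryHypergeometricSeries ℂ a b c).derivSeries_coeff_one n
    rw [FormalMultilinearSeries.apply_eq_pow_smul_coeff]
    simp only [map_smul, ContinuousLinearMap.apply_apply]
    rw [this]
    simp [ordinaryHypergeometricSeries, FormalMultilinearSeries.coeff_ofScalars, coeff]
    ring
  simp only [h2] at h1
  have h3 := ((hasSum (a + 1) (b + 1) (c + 1) hz).mul_left (a * b / c)).unique h1
  rw [h3]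
  simpa using (analyticAt a b c hz).differentiableAt.hasFDerivAt.hasDerivAt

/-- The hypergeometric differential equation. -/
theorem differential_equation {a b c : ℂ} (hc : ∀ k : ℕ, c ≠ -k) {z : ℂ} (hz : ‖z‖ < 1) :
    z * (1 - z) * ((a + 1) * (b + 1) / (c + 1) * (a * b / c) * F (a + 2) (b + 2) (c + 2) z) +
      (c - (a + b + 1) * z) * (a * b / c * F (a + 1) (b + 1) (c + 1) z) - a * b * F a b c z = 0 := by
  set t := coeff a b c with ht
  have e1 : ∀ n : ℕ, a * b / c * coeff (a + 1) (b + 1) (c + 1) n = ((n : ℂ) + 1) * t (n + 1) :=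
    fun n => (succ_mul_coefficient_succ a b c n).symm
  have e2 : ∀ n : ℕ, (a + 1) * (b + 1) / (c + 1) * (a * b / c) * coeff (a + 2) (b + 2) (c + 2) n =
      ((n : ℂ) + 1) * (((n : ℂ) + 2) * t (n + 2)) := by
    intro n
    have h := succ_mul_coefficient_succ (a + 1) (b + 1) (c + 1) n
    have h' := e1 (n + 1)
    push_cast at h'
    have e (x : ℂ) : x + 1 + 1 = x + 2 := by ring
    rw [e, e, e] at h
    rw [e] at h'
    rw [← h', ← mul_assoc, mul_comm ((n : ℂ) + 1), mul_assoc (a * b / c), h]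
    ring
  have s0 := hasSum a b c hz
  have s1 := (hasSum (a + 1) (b + 1) (c + 1) hz).mul_left (a * b / c)
  have s2 := (hasSum (a + 2) (b + 2) (c + 2) hz).mul_left
    ((a + 1) * (b + 1) / (c + 1) * (a * b / c))
  simp only [← mul_assoc] at s1 s2
  simp only [e1] at s1
  simp only [e2] at s2
  have z1 : HasSum (fun n : ℕ => (n : ℂ) * t n * z ^ n)
      (z * (a * b / c * F (a + 1) (b + 1) (c + 1) z)) := by
    refine (hasSum_nat_add_iff' 1).1 ?_
    simp only [Finset.range_one, Finset.sum_singleton, Nat.cast_zero, zero_mul, sub_zero]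
    refine (s1.mul_left z).congr_fun fun n => ?_
    push_cast; ring
  have z2 : HasSum (fun n : ℕ => (n : ℂ) * ((n + 1) * t (n + 1)) * z ^ n)
      (z * ((a + 1) * (b + 1) / (c + 1) * (a * b / c) * F (a + 2) (b + 2) (c + 2) z)) := by
    refine (hasSum_nat_add_iff' 1).1 ?_
    simp only [Finset.range_one, Finset.sum_singleton, Nat.cast_zero, zero_mul, sub_zero]
    refine (s2.mul_left z).congr_fun fun n => ?_
    push_cast; ring_nf
  have z3 : HasSum (fun n : ℕ => (n : ℂ) * (n - 1) * t n * z ^ n)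
      (z ^ 2 * ((a + 1) * (b + 1) / (c + 1) * (a * b / c) * F (a + 2) (b + 2) (c + 2) z)) := by
    refine (hasSum_nat_add_iff' 1).1 ?_
    simp only [Finset.range_one, Finset.sum_singleton, Nat.cast_zero, zero_mul, sub_zero]
    rw [pow_two, mul_assoc]
    refine (z2.mul_left z).congr_fun fun n => ?_
    push_cast; ring_nf
  have total := (((z2.sub z3).add (s1.mul_left c)).sub (z1.mul_left (a + b + 1))).sub
    (s0.mul_left (a * b))
  -- Comparing coefficients of z^n, the equation is the recursion (c + n)(n + 1) t(n+1) = (a + n)(b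
  -- + n) t(n).
  have h0 : ∀ n : ℕ, (n : ℂ) * ((n + 1) * t (n + 1)) * z ^ n - (n : ℂ) * (n - 1) * t n * z ^ n +
      c * (((n : ℂ) + 1) * t (n + 1) * z ^ n) - (a + b + 1) * ((n : ℂ) * t n * z ^ n) -
      a * b * (t n * z ^ n) = 0 := by
    intro n
    have h2 : c + n ≠ 0 := fun h => hc n (eq_neg_of_add_eq_zero_left h)
    have h3 : (n : ℂ) + 1 ≠ 0 := Nat.cast_add_one_ne_zero n
    have : (c + n) * ((n + 1) * t (n + 1)) = (a + n) * (b + n) * t n := by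
      rw [ht, coefficient_succ hc n]; field_simp
    linear_combination z ^ n * this
  have := (total.congr_fun fun n => (h0 n).symm).unique hasSum_zero
  linear_combination this

/-- A solution of the hypergeometric equation that is analytic at `0` and vanishes there is zero. -/
theorem eventuallyEq_zero_of_differential_equation {a b c : ℂ} (hc : ∀ k : ℕ, c ≠ -k)
    {f f₁ f₂ : ℂ → ℂ} (hf : AnalyticAt ℂ f 0) (hf0 : f 0 = 0)
    (h₁ : ∀ᶠ z in 𝓝 0, HasDerivAt f (f₁ z) z) (h₂ : ∀ᶠ z in 𝓝 0, HasDerivAt f₁ (f₂ z) z)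
    (hode : ∀ᶠ z in 𝓝 0,
      z * (1 - z) * f₂ z + (c - (a + b + 1) * z) * f₁ z - a * b * f z = 0) :
    ∀ᶠ z in 𝓝 0, f z = 0 := by
  by_contra hcon
  -- Write f = z^(m+1) g with g(0) ≠ 0. The lowest order term of the equation is (m + 1)(c + m) g(0)
  -- z^m, the indicial polynomial at the exponent m + 1, which is nonzero by the condition on c.
  obtain ⟨n, g, hg, hg0, hfg⟩ := hf.exists_eventuallyEq_pow_smul_nonzero_iff.2 hcon
  simp only [sub_zero, smul_eq_mul] at hfg
  obtain ⟨m, rfl⟩ : ∃ m, n = m + 1 := by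
    refine Nat.exists_eq_succ_of_ne_zero ?_
    rintro rfl
    have := hfg.self_of_nhds
    simp_all
  have dg : ∀ᶠ z in 𝓝 (0 : ℂ), HasDerivAt g (deriv g z) z :=
    hg.eventually_analyticAt.mono fun z hz => hz.differentiableAt.hasDerivAt
  have dg' : ∀ᶠ z in 𝓝 (0 : ℂ), HasDerivAt (deriv g) (deriv (deriv g) z) z :=
    hg.deriv.eventually_analyticAt.mono fun z hz => hz.differentiableAt.hasDerivAt
  have e₁ : ∀ᶠ z in 𝓝 (0 : ℂ), f₁ z = (m + 1) * z ^ m * g z + z ^ (m + 1) * deriv g z := by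
    filter_upwards [h₁, dg, hfg.eventually_nhds] with z hz hgz hfz
    have h := ((hasDerivAt_pow (m + 1) z).mul hgz).congr_of_eventuallyEq hfz
    have := hz.unique h
    rw [this]; push_cast; simp
  have e₂ : ∀ᶠ z in 𝓝 (0 : ℂ), z * f₂ z = z ^ m *
      (m * (m + 1) * g z + z * ((2 * m + 2) * deriv g z + z * deriv (deriv g) z)) := by
    have e₁' : ∀ᶠ z in 𝓝 (0 : ℂ), z * f₁ z = (m + 1) * f z + z ^ (m + 2) * deriv g z := by
      filter_upwards [e₁, hfg] with z hz hfz
      rw [hz, hfz]; ring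
    filter_upwards [h₁, h₂, dg', e₁'.eventually_nhds, e₁] with z hz hz' hgz he he'
    have h := ((hz.const_mul ((m : ℂ) + 1)).add
      ((hasDerivAt_pow (m + 2) z).mul hgz)).congr_of_eventuallyEq he
    have := ((hasDerivAt_id z).mul hz').unique h
    simp only [id_eq, one_mul] at this
    push_cast at this
    linear_combination this + (m : ℂ) * he'
  have e₃ : ∀ᶠ z in 𝓝[≠] (0 : ℂ), (1 - z) *
      (m * (m + 1) * g z + z * ((2 * m + 2) * deriv g z + z * deriv (deriv g) z)) +
      (c - (a + b + 1) * z) * ((m + 1) * g z + z * deriv g z) - a * b * z * g z = 0 := by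
    filter_upwards [eventually_nhdsWithin_of_eventually_nhds e₁,
      eventually_nhdsWithin_of_eventually_nhds e₂, eventually_nhdsWithin_of_eventually_nhds hode,
      eventually_nhdsWithin_of_eventually_nhds hfg, self_mem_nhdsWithin] with z k₁ k₂ k₃ k₄ hz
    refine (mul_eq_zero.1 (?_ : z ^ m * _ = 0)).resolve_left (pow_ne_zero m hz)
    rw [k₁, k₄] at k₃
    linear_combination k₃ - (1 - z) * k₂
  have hcont : ContinuousAt (fun z : ℂ => (1 - z) *
      (m * (m + 1) * g z + z * ((2 * m + 2) * deriv g z + z * deriv (deriv g) z)) +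
      (c - (a + b + 1) * z) * ((m + 1) * g z + z * deriv g z) - a * b * z * g z) 0 := by
    have := hg.continuousAt
    have := hg.deriv.continuousAt
    have := hg.deriv.deriv.continuousAt
    fun_prop
  have hlim := tendsto_nhds_unique (hcont.tendsto.mono_left nhdsWithin_le_nhds)
    (tendsto_const_nhds.congr' (e₃.mono fun z hz => hz.symm))
  have : (m + 1) * (c + m) * g 0 = 0 := by linear_combination hlim
  have hm : (m : ℂ) + 1 ≠ 0 := Nat.cast_add_one_ne_zero m
  exact hc m (eq_neg_of_add_eq_zero_left (by simpa [hm, hg0] using this))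

theorem symm (a b c z : ℂ) : F a b c z = F b a c z := by
  rw [ordinaryHypergeometric, ordinaryHypergeometricSeries_symm, ordinaryHypergeometric]

theorem one_sub_mem_slitPlane {z : ℂ} (hz : ‖z‖ < 1) : 1 - z ∈ Complex.slitPlane := by
  rw [sub_eq_add_neg]
  exact Complex.mem_slitPlane_of_norm_lt_one (by simpa using hz)

/-- **Pfaff's transformation** near the origin. -/
theorem pfaff {a b c : ℂ} (hc : ∀ k : ℕ, c ≠ -k) :
    ∀ᶠ z in 𝓝 (0 : ℂ), F a b c z = (1 - z) ^ (-a) * F a (c - b) c (z / (z - 1)) := by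
  have hball : ∀ᶠ z in 𝓝 (0 : ℂ), ‖z‖ < 1 :=
    continuous_norm.continuousAt.eventually_lt continuousAt_const (by simp)
  have hball' : ∀ᶠ z in 𝓝 (0 : ℂ), ‖z / (z - 1)‖ < 1 := by
    have : ContinuousAt (fun z : ℂ => z / (z - 1)) 0 := by
      refine ContinuousAt.div continuousAt_id (by fun_prop) (by simp)
    exact this.norm.eventually_lt continuousAt_const (by simp)
  set p : ℂ → ℂ := fun z => (1 - z) ^ (-a)
  set d : ℂ := c - b
  set G : ℂ → ℂ := fun z => F a d c (z / (z - 1)) with hG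
  set G₁ : ℂ → ℂ := fun z => a * d / c * F (a + 1) (d + 1) (c + 1) (z / (z - 1)) with hG₁
  set G₂ : ℂ → ℂ := fun z => (a + 1) * (d + 1) / (c + 1) * (a * d / c) *
    F (a + 2) (d + 2) (c + 2) (z / (z - 1)) with hG₂
  have dp : ∀ z : ℂ, ‖z‖ < 1 → HasDerivAt p (a * p z / (1 - z)) z := by
    intro z hz
    have hs := one_sub_mem_slitPlane hz
    have h := ((hasDerivAt_id z).const_sub 1).cpow_const (c := -a) hs
    refine h.congr_deriv ?_
    simp only [id_eq, p]
    rw [Complex.cpow_sub _ _ (Complex.slitPlane_ne_zero hs), Complex.cpow_one]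
    ring
  have dt : ∀ z : ℂ, ‖z‖ < 1 → HasDerivAt (fun z : ℂ => z / (z - 1)) (-1 / (1 - z) ^ 2) z := by
    intro z hz
    have hs := Complex.slitPlane_ne_zero (one_sub_mem_slitPlane hz)
    have hs' : z - 1 ≠ 0 := by rwa [← neg_ne_zero, neg_sub]
    refine ((hasDerivAt_id z).div ((hasDerivAt_id z).sub_const 1) hs').congr_deriv ?_
    simp only [id_eq]
    rw [div_eq_div_iff (by positivity) (by positivity)]
    ring
  have dG : ∀ z : ℂ, ‖z‖ < 1 → ‖z / (z - 1)‖ < 1 →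
      HasDerivAt G (G₁ z * (-1 / (1 - z) ^ 2)) z :=
    fun z hz hz' => (hasDerivAt a d c hz').comp z (dt z hz)
  have dG₁ : ∀ z : ℂ, ‖z‖ < 1 → ‖z / (z - 1)‖ < 1 →
      HasDerivAt G₁ (G₂ z * (-1 / (1 - z) ^ 2)) z := by
    intro z hz hz'
    refine (((hasDerivAt (a + 1) (d + 1) (c + 1) hz').comp z (dt z hz)).const_mul
      (a * d / c)).congr_deriv ?_
    have e (x : ℂ) : x + 1 + 1 = x + 2 := by ring
    simp only [hG₂, e]
    ring
  -- The difference of the two sides vanishes at 0 and solves the equation with parameters a, b, c;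
  -- `f₁` and `f₂` are its first two derivatives.
  have key := eventuallyEq_zero_of_differential_equation (a := a) (b := b) hc
    (f := fun z => F a b c z - p z * G z)
    (f₁ := fun z => a * b / c * F (a + 1) (b + 1) (c + 1) z -
      (p z * (a * G z / (1 - z) - G₁ z / (1 - z) ^ 2)))
    (f₂ := fun z => (a + 1) * (b + 1) / (c + 1) * (a * b / c) * F (a + 2) (b + 2) (c + 2) z -
      p z * (a * (a + 1) * G z / (1 - z) ^ 2 - (2 * a + 2) * G₁ z / (1 - z) ^ 3 +
        G₂ z / (1 - z) ^ 4)) ?_ ?_ ?_ ?_ ?_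
  · exact key.mono fun z hz => sub_eq_zero.1 hz
  · have h1 : AnalyticAt ℂ (fun z : ℂ => z / (z - 1)) 0 :=
      analyticAt_id.div (analyticAt_id.sub analyticAt_const) (by simp)
    have h2 : AnalyticAt ℂ G 0 :=
      AnalyticAt.fun_comp (analyticAt a d c (by simp)) h1
    have h3 : AnalyticAt ℂ p 0 :=
      (analyticAt_const.sub analyticAt_id).cpow analyticAt_const (by simp)
    exact (analyticAt a b c (by simp)).sub (h3.mul h2)
  · simp [p, hG]
  · filter_upwards [hball, hball'] with z hz hz'
    have hs := Complex.slitPlane_ne_zero (one_sub_mem_slitPlane hz)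
    refine ((hasDerivAt a b c hz).sub ((dp z hz).mul (dG z hz hz'))).congr_deriv ?_
    field_simp
    ring
  · filter_upwards [hball, hball'] with z hz hz'
    have hs := Complex.slitPlane_ne_zero (one_sub_mem_slitPlane hz)
    have d0 : HasDerivAt (fun z : ℂ => 1 - z) (-1) z := by
      simpa using (hasDerivAt_id z).const_sub 1
    have e (x : ℂ) : x + 1 + 1 = x + 2 := by ring
    refine (((hasDerivAt (a + 1) (b + 1) (c + 1) hz).const_mul (a * b / c)).sub ((dp z hz).mul
      ((((dG z hz hz').const_mul a).div d0 hs).sub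
        ((dG₁ z hz hz').div (d0.pow 2) (pow_ne_zero 2 hs))))).congr_deriv ?_
    simp only [e, Pi.pow_apply, Pi.div_apply, Pi.sub_apply]
    field_simp
    ring
  · filter_upwards [hball, hball'] with z hz hz'
    have hs := Complex.slitPlane_ne_zero (one_sub_mem_slitPlane hz)
    have hs' : z - 1 ≠ 0 := by rwa [← neg_ne_zero, neg_sub]
    have o1 := differential_equation (a := a) (b := b) hc hz
    have o2 := differential_equation (a := a) (b := d) hc hz'
    change _ * G₂ z + _ * G₁ z - _ * G z = 0 at o2
    -- The equation of F(a, d; c; t) at t = z/(z - 1), rewritten in z with t(1 - t) = -z/(1 - z)².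
    have o3 : z * G₂ z / (1 - z) ^ 2 - (c * (1 - z) + (a + d + 1) * z) * G₁ z / (1 - z) +
        a * d * G z = 0 := by
      have e1 : z / (z - 1) * (1 - z / (z - 1)) = - z / (1 - z) ^ 2 := by
        rw [show (1 - z) ^ 2 = (z - 1) ^ 2 by ring]; field_simp; ring
      have e2 : c - (a + d + 1) * (z / (z - 1)) = (c * (1 - z) + (a + d + 1) * z) / (1 - z) := by
        rw [show z - 1 = -(1 - z) by ring]; field_simp; ring
      rw [e1, e2] at o2
      linear_combination -o2
    have o4 : z * (1 - z) * (p z * (a * (a + 1) * G z / (1 - z) ^ 2 -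
        (2 * a + 2) * G₁ z / (1 - z) ^ 3 + G₂ z / (1 - z) ^ 4)) +
        (c - (a + b + 1) * z) * (p z * (a * G z / (1 - z) - G₁ z / (1 - z) ^ 2)) -
        a * b * (p z * G z) = p z / (1 - z) * (z * G₂ z / (1 - z) ^ 2 -
          (c * (1 - z) + (a + d + 1) * z) * G₁ z / (1 - z) + a * d * G z) := by
      field_simp
      simp only [d]
      ring
    linear_combination o1 - o4 - p z / (1 - z) * o3

/-- **Euler's transformation**. -/
theorem euler {a b c z : ℂ} (hc : ∀ k : ℕ, c ≠ -k) (hz : ‖z‖ < 1) :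
    F a b c z = (1 - z) ^ (c - a - b) * F (c - a) (c - b) c z := by
  have h1 : AnalyticOnNhd ℂ (F a b c) (Metric.ball 0 1) := fun w hw =>
    analyticAt a b c (mem_ball_zero_iff.1 hw)
  have h2 : AnalyticOnNhd ℂ (fun z => (1 - z) ^ (c - a - b) * F (c - a) (c - b) c z)
      (Metric.ball 0 1) := fun w hw =>
    ((analyticAt_const.sub analyticAt_id).cpow analyticAt_const
      (one_sub_mem_slitPlane (mem_ball_zero_iff.1 hw))).mul
      (analyticAt (c - a) (c - b) c (mem_ball_zero_iff.1 hw))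
  -- By the identity theorem agreement near 0 is enough. There Pfaff's transformation is used twice,
  -- the second time in the other upper parameter; z ↦ z/(z - 1) is an involution.
  refine h1.eqOn_of_preconnected_of_eventuallyEq h2 (convex_ball 0 1).isPreconnected
    (Metric.mem_ball_self one_pos) ?_ (mem_ball_zero_iff.2 hz)
  have hcont : Tendsto (fun z : ℂ => z / (z - 1)) (𝓝 0) (𝓝 0) := by
    have : ContinuousAt (fun z : ℂ => z / (z - 1)) 0 :=
      ContinuousAt.div continuousAt_id (by fun_prop) (by simp)
    simpa using this.tendsto
  have hball : ∀ᶠ z in 𝓝 (0 : ℂ), ‖z‖ < 1 :=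
    continuous_norm.continuousAt.eventually_lt continuousAt_const (by simp)
  filter_upwards [pfaff (a := a) (b := b) hc, hcont.eventually (pfaff (a := c - b) (b := a) hc),
    hball] with z h h' hz
  have hs := one_sub_mem_slitPlane hz
  have hs0 := Complex.slitPlane_ne_zero hs
  have hs1 : z - 1 ≠ 0 := by rwa [← neg_ne_zero, neg_sub]
  have e1 : 1 - z / (z - 1) = (1 - z)⁻¹ := by
    rw [← neg_sub z 1]; field_simp; ring
  have e2 : z / (z - 1) / (z / (z - 1) - 1) = z := by
    have : z / (z - 1) - 1 = (z - 1)⁻¹ := by field_simp; ring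
    rw [this]; field_simp
  rw [e1, e2, Complex.inv_cpow _ _ (Complex.slitPlane_arg_ne_pi hs), Complex.cpow_neg,
    inv_inv] at h'
  rw [h, symm, h', symm, ← mul_assoc, ← Complex.cpow_add _ _ hs0]
  congr 2
  ring

/-- The value of the principal branch on the negative real axis. -/
theorem hypF_neg_ofReal {a b c : ℂ} (hc : ∀ k : ℕ, c ≠ -k) {x : ℝ} (hx : 0 ≤ x) :
    Siegel.hypF a b c (-(x : ℂ)) =
      ((1 + x : ℝ) : ℂ) ^ (-a) * F a (c - b) c ((x / (1 + x) : ℝ) : ℂ) := by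
  have hx1 : (1 : ℂ) + x ≠ 0 := by
    norm_cast; positivity
  -- Pfaff's right-hand side is the continuation along the segment, since z/(z - 1) maps [-x, 0]
  -- into [0, 1).
  rw [Siegel.hypF_eq (f := fun z => (1 - z) ^ (-a) * F a (c - b) c (z / (z - 1))) ?_
    ((pfaff hc).mono fun z hz => hz.symm)]
  · push_cast
    rw [sub_neg_eq_add]
    congr 2
    rw [show -(x : ℂ) - 1 = -(1 + x) by ring, neg_div_neg_eq]
  · intro z hz
    rw [segment_eq_image] at hz
    obtain ⟨t, ⟨ht0, -⟩, rfl⟩ := hz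
    have hy : 0 ≤ t * x := mul_nonneg ht0 hx
    have hz : (1 - t) • (0 : ℂ) + t • -(x : ℂ) = ((-(t * x) : ℝ) : ℂ) := by simp
    beta_reduce
    rw [hz]
    set y := t * x
    have h1 : (1 : ℂ) - ((-y : ℝ) : ℂ) ∈ Complex.slitPlane := by
      left; simp; linarith
    have h2 : ((-y : ℝ) : ℂ) - 1 ≠ 0 := by
      rw [← neg_ne_zero, neg_sub]; exact Complex.slitPlane_ne_zero h1
    have h3 : ‖((-y : ℝ) : ℂ) / (((-y : ℝ) : ℂ) - 1)‖ < 1 := by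
      have : ((-y : ℝ) : ℂ) / (((-y : ℝ) : ℂ) - 1) = ((y / (1 + y) : ℝ) : ℂ) := by
        have : (1 : ℂ) + y ≠ 0 := by norm_cast; positivity
        push_cast
        rw [show -(y : ℂ) - 1 = -(1 + y) by ring, neg_div_neg_eq]
      rw [this, Complex.norm_real, Real.norm_of_nonneg (by positivity), div_lt_one (by positivity)]
      linarith
    have h4 : AnalyticAt ℂ (fun z : ℂ => z / (z - 1)) ((-y : ℝ) : ℂ) :=
      analyticAt_id.div (analyticAt_id.sub analyticAt_const) h2
    have h5 : AnalyticAt ℂ (fun z : ℂ => F a (c - b) c (z / (z - 1))) ((-y : ℝ) : ℂ) :=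
      AnalyticAt.fun_comp (g := F a (c - b) c) (analyticAt a (c - b) c h3) h4
    exact ((analyticAt_const.sub analyticAt_id).cpow analyticAt_const h1).mul h5

/-! ### Wronskians and the connection between ξ = 1 and ξ = 0 -/

/-- Derivative of the Wronskian of solutions `ξ ^ s G` and `ξ ^ (2 - s) H` of the radial equation,
with the powers of `ξ` cancelled. -/
theorem hasDerivAt_wronskian {s ξ : ℂ} {G G' H H' : ℂ → ℂ} {G'' H'' : ℂ}
    (hG : HasDerivAt G (G' ξ) ξ) (hG' : HasDerivAt G' G'' ξ)
    (hH : HasDerivAt H (H' ξ) ξ) (hH' : HasDerivAt H' H'' ξ)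
    (oG : ξ * (1 - ξ) * G'' + (2 * s - 1 - (2 * s + 1) * ξ) * G' ξ - s * s * G ξ = 0)
    (oH : ξ * (1 - ξ) * H'' + (3 - 2 * s - (5 - 2 * s) * ξ) * H' ξ -
      (2 - s) * (2 - s) * H ξ = 0) :
    HasDerivAt (fun ξ => (1 - ξ) ^ 2 * (G ξ * ((2 - s) * H ξ + ξ * H' ξ) -
      H ξ * (s * G ξ + ξ * G' ξ))) 0 ξ := by
  -- By Abel's formula the Wronskian of ξ^s G and ξ^(2-s) H is a constant times ξ (1 - ξ)⁻², which
  -- explains the factor (1 - ξ)².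
  have d0 : HasDerivAt (fun z : ℂ => 1 - z) (-1) ξ := by
    simpa using (hasDerivAt_id ξ).const_sub 1
  refine ((d0.pow 2).mul ((hG.mul ((hH.const_mul (2 - s)).add ((hasDerivAt_id ξ).mul hH'))).sub
    (hH.mul ((hG.const_mul s).add ((hasDerivAt_id ξ).mul hG'))))).congr_deriv ?_
  simp
  linear_combination (1 - ξ) * (G ξ * oH - H ξ * oG)

/-- The region `|ξ| < 1`, `|1 - ξ| < 1`. -/
def lens : Set ℂ := Metric.ball 0 1 ∩ Metric.ball 1 1

theorem isOpen_lens : IsOpen lens := Metric.isOpen_ball.inter Metric.isOpen_ball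

theorem isPreconnected_lens : IsPreconnected lens :=
  ((convex_ball 0 1).inter (convex_ball 1 1)).isPreconnected

theorem mem_lens {ξ : ℂ} : ξ ∈ lens ↔ ‖ξ‖ < 1 ∧ ‖1 - ξ‖ < 1 := by
  simp [lens, dist_eq_norm, norm_sub_rev]

theorem half_mem_lens : (1 / 2 : ℂ) ∈ lens := by
  rw [mem_lens]; norm_num

/-- The Wronskian at `ξ` of the solution regular at `ξ = 1` and the solution with exponent
`2 - s` at `ξ = 0`. -/
noncomputable def regularWronskian (s ξ : ℂ) : ℂ :=
  (1 - ξ) ^ 2 * (F s s 2 (1 - ξ) * ((2 - s) * F (2 - s) (2 - s) (3 - 2 * s) ξ +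
    ξ * ((2 - s) * (2 - s) / (3 - 2 * s) * F (3 - s) (3 - s) (4 - 2 * s) ξ)) -
    F (2 - s) (2 - s) (3 - 2 * s) ξ * (s * F s s 2 (1 - ξ) +
      ξ * -(s * s / 2 * F (s + 1) (s + 1) 3 (1 - ξ))))

section

variable {s : ℂ}

theorem two_ne_neg_natCast (k : ℕ) : (2 : ℂ) ≠ -k := by
  intro h
  have : ((2 + k : ℕ) : ℂ) = 0 := by push_cast; rw [h]; ring
  rw [Nat.cast_eq_zero] at this
  omega

theorem two_mul_sub_one_ne (hs : ∀ n : ℤ, 2 * s ≠ n) (k : ℕ) : 2 * s - 1 ≠ -k := by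
  intro h
  refine hs (1 - k) ?_
  push_cast
  linear_combination h

theorem three_sub_two_mul_ne (hs : ∀ n : ℤ, 2 * s ≠ n) (k : ℕ) : 3 - 2 * s ≠ -k := by
  intro h
  refine hs (3 + k) ?_
  push_cast
  linear_combination -h

theorem two_mul_two_sub_ne (hs : ∀ n : ℤ, 2 * s ≠ n) (n : ℤ) : 2 * (2 - s) ≠ n := by
  intro h
  refine hs (4 - n) ?_
  push_cast
  linear_combination -h

/-- The solution at `ξ = 0`, its derivatives and its equation. -/
theorem solution_zero (hs : ∀ n : ℤ, 2 * s ≠ n) {ξ : ℂ} (hξ : ‖ξ‖ < 1) :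
    HasDerivAt (F s s (2 * s - 1)) (s * s / (2 * s - 1) * F (s + 1) (s + 1) (2 * s) ξ) ξ ∧
    ∃ D, HasDerivAt (fun ξ => s * s / (2 * s - 1) * F (s + 1) (s + 1) (2 * s) ξ) D ξ ∧
      ξ * (1 - ξ) * D + (2 * s - 1 - (2 * s + 1) * ξ) *
        (s * s / (2 * s - 1) * F (s + 1) (s + 1) (2 * s) ξ) - s * s * F s s (2 * s - 1) ξ = 0 := by
  have e : 2 * s - 1 + 1 = 2 * s := by ring
  have h1 := hasDerivAt s s (2 * s - 1) hξ
  have h2 := (hasDerivAt (s + 1) (s + 1) (2 * s) hξ).const_mul (s * s / (2 * s - 1))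
  have h3 := differential_equation (a := s) (b := s) (two_mul_sub_one_ne hs) hξ
  rw [e] at h1 h3
  refine ⟨h1, _, h2, ?_⟩
  have e1 : s + 1 + 1 = s + 2 := by ring
  have e2 : 2 * s - 1 + 2 = 2 * s + 1 := by ring
  rw [e1]
  rw [e2] at h3
  linear_combination h3

theorem solution_zero' (hs : ∀ n : ℤ, 2 * s ≠ n) {ξ : ℂ} (hξ : ‖ξ‖ < 1) :
    HasDerivAt (F (2 - s) (2 - s) (3 - 2 * s))
      ((2 - s) * (2 - s) / (3 - 2 * s) * F (3 - s) (3 - s) (4 - 2 * s) ξ) ξ ∧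
    ∃ D, HasDerivAt
      (fun ξ => (2 - s) * (2 - s) / (3 - 2 * s) * F (3 - s) (3 - s) (4 - 2 * s) ξ) D ξ ∧
      ξ * (1 - ξ) * D + (3 - 2 * s - (5 - 2 * s) * ξ) *
        ((2 - s) * (2 - s) / (3 - 2 * s) * F (3 - s) (3 - s) (4 - 2 * s) ξ) -
        (2 - s) * (2 - s) * F (2 - s) (2 - s) (3 - 2 * s) ξ = 0 := by
  have h := solution_zero (two_mul_two_sub_ne hs) hξ
  rw [show 2 * (2 - s) - 1 = 3 - 2 * s by ring, show 2 - s + 1 = 3 - s by ring,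
    show 2 * (2 - s) + 1 = 5 - 2 * s by ring, show 2 * (2 - s) = 4 - 2 * s by ring] at h
  exact h

/-- The solution regular at `ξ = 1`, its derivatives and its equation. -/
theorem solution_one (s : ℂ) {ξ : ℂ} (hξ : ‖1 - ξ‖ < 1) :
    HasDerivAt (fun ξ => F s s 2 (1 - ξ)) (-(s * s / 2 * F (s + 1) (s + 1) 3 (1 - ξ))) ξ ∧
    ∃ D, HasDerivAt (fun ξ => -(s * s / 2 * F (s + 1) (s + 1) 3 (1 - ξ))) D ξ ∧
      ξ * (1 - ξ) * D + (2 * s - 1 - (2 * s + 1) * ξ) *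
        -(s * s / 2 * F (s + 1) (s + 1) 3 (1 - ξ)) - s * s * F s s 2 (1 - ξ) = 0 := by
  have e : (2 : ℂ) + 1 = 3 := by norm_num
  have d0 : HasDerivAt (fun z : ℂ => 1 - z) (-1) ξ := by
    simpa using (hasDerivAt_id ξ).const_sub 1
  have h1 := (hasDerivAt s s 2 hξ).comp ξ d0
  have h2 := (((hasDerivAt (s + 1) (s + 1) 3 hξ).comp ξ d0).const_mul (s * s / 2)).neg
  have h3 := differential_equation (a := s) (b := s) two_ne_neg_natCast hξ
  rw [e] at h1 h3
  refine ⟨h1.congr_deriv (by ring), _, h2, ?_⟩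
  rw [show s + 1 + 1 = s + 2 by ring, show (3 : ℂ) + 1 = 2 + 2 by norm_num]
  linear_combination h3

/-- The derivative vanishes on a connected open set. The base point 1/2 is a convenient choice:
there both series converge for all admissible s, so the constant is holomorphic in s. -/
theorem regularWronskian_eq (hs : ∀ n : ℤ, 2 * s ≠ n) {ξ : ℂ} (hξ : ξ ∈ lens) :
    regularWronskian s ξ = regularWronskian s (1 / 2) := by
  have key : ∀ z ∈ lens, HasDerivAt (regularWronskian s) 0 z := by
    intro z hz
    obtain ⟨hz0, hz1⟩ := mem_lens.1 hz
    obtain ⟨a1, _, a2, a3⟩ := solution_one s hz1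
    obtain ⟨b1, _, b2, b3⟩ := solution_zero' hs hz0
    exact hasDerivAt_wronskian a1 a2 b1 b2 a3 b3
  exact isOpen_lens.is_const_of_deriv_eq_zero isPreconnected_lens
    (fun z hz => (key z hz).differentiableAt.differentiableWithinAt)
    (fun z hz => (key z hz).deriv) hξ half_mem_lens

/-- The constant is read off at ξ = 0, as (2 - s) - s. -/
theorem wronskian_zero (hs : ∀ n : ℤ, 2 * s ≠ n) {ξ : ℂ} (hξ : ‖ξ‖ < 1) :
    (1 - ξ) ^ 2 * (F s s (2 * s - 1) ξ * ((2 - s) * F (2 - s) (2 - s) (3 - 2 * s) ξ +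
      ξ * ((2 - s) * (2 - s) / (3 - 2 * s) * F (3 - s) (3 - s) (4 - 2 * s) ξ)) -
      F (2 - s) (2 - s) (3 - 2 * s) ξ * (s * F s s (2 * s - 1) ξ +
        ξ * (s * s / (2 * s - 1) * F (s + 1) (s + 1) (2 * s) ξ))) = 2 - 2 * s := by
  have key : ∀ z ∈ Metric.ball (0 : ℂ) 1, HasDerivAt (fun ξ =>
      (1 - ξ) ^ 2 * (F s s (2 * s - 1) ξ * ((2 - s) * F (2 - s) (2 - s) (3 - 2 * s) ξ +
      ξ * ((2 - s) * (2 - s) / (3 - 2 * s) * F (3 - s) (3 - s) (4 - 2 * s) ξ)) -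
      F (2 - s) (2 - s) (3 - 2 * s) ξ * (s * F s s (2 * s - 1) ξ +
        ξ * (s * s / (2 * s - 1) * F (s + 1) (s + 1) (2 * s) ξ)))) 0 z := by
    intro z hz
    rw [mem_ball_zero_iff] at hz
    obtain ⟨a1, _, a2, a3⟩ := solution_zero hs hz
    obtain ⟨b1, _, b2, b3⟩ := solution_zero' hs hz
    exact hasDerivAt_wronskian a1 a2 b1 b2 a3 b3
  rw [Metric.isOpen_ball.is_const_of_deriv_eq_zero (convex_ball 0 1).isPreconnected
    (fun z hz => (key z hz).differentiableAt.differentiableWithinAt)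
    (fun z hz => (key z hz).deriv) (mem_ball_zero_iff.2 hξ) (Metric.mem_ball_self one_pos)]
  simp
  ring

theorem lens_subset_slitPlane {ξ : ℂ} (hξ : ξ ∈ lens) : ξ ∈ Complex.slitPlane := by
  simpa using one_sub_mem_slitPlane (mem_lens.1 hξ).2

/-- Equivalently, ξ^s F(s, s; 2; 1 - ξ) is invariant under s ↦ 2 - s. Hence one connection
coefficient determines the other. -/
theorem euler_two {ξ : ℂ} (hξ : ξ ∈ lens) :
    F s s 2 (1 - ξ) = ξ ^ (2 - 2 * s) * F (2 - s) (2 - s) 2 (1 - ξ) := by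
  rw [euler two_ne_neg_natCast (mem_lens.1 hξ).2, sub_sub_cancel]
  congr 2
  ring

theorem euler_two_deriv {ξ : ℂ} (hξ : ξ ∈ lens) :
    s * F s s 2 (1 - ξ) + ξ * -(s * s / 2 * F (s + 1) (s + 1) 3 (1 - ξ)) =
      ξ ^ (2 - 2 * s) * ((2 - s) * F (2 - s) (2 - s) 2 (1 - ξ) +
        ξ * -((2 - s) * (2 - s) / 2 * F (3 - s) (3 - s) 3 (1 - ξ))) := by
  have h0 := Complex.slitPlane_ne_zero (lens_subset_slitPlane hξ)
  have h1 := (solution_one s (mem_lens.1 hξ).2).1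
  have h2 := (solution_one (2 - s) (mem_lens.1 hξ).2).1
  have h3 := ((hasDerivAt_id ξ).cpow_const (c := 2 - 2 * s) (lens_subset_slitPlane hξ)).mul h2
  have h4 : (fun ξ => F s s 2 (1 - ξ)) =ᶠ[𝓝 ξ]
      fun ξ => ξ ^ (2 - 2 * s) * F (2 - s) (2 - s) 2 (1 - ξ) := by
    filter_upwards [isOpen_lens.mem_nhds hξ] with z hz using euler_two hz
  have h5 := h1.unique (h3.congr_of_eventuallyEq h4)
  rw [h5, euler_two hξ]
  simp only [id_eq]
  rw [Complex.cpow_sub _ 1 h0, Complex.cpow_one, show 2 - s + 1 = 3 - s by ring]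
  field_simp
  ring

/-- The connection between the solution regular at `ξ = 1` and the solutions at `ξ = 0`, with
coefficients given as Wronskians. -/
theorem connection_wronskian (hs : ∀ n : ℤ, 2 * s ≠ n) {ξ : ℂ} (hξ : ξ ∈ lens) :
    (2 - 2 * s) * F s s 2 (1 - ξ) = regularWronskian s (1 / 2) * F s s (2 * s - 1) ξ -
      regularWronskian (2 - s) (1 / 2) *
        (ξ ^ (2 - 2 * s) * F (2 - s) (2 - s) (3 - 2 * s) ξ) := by
  rw [← regularWronskian_eq hs hξ, ← regularWronskian_eq (two_mul_two_sub_ne hs) hξ, regularWronskian, regularWronskian]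
  have e1 := euler_two (s := s) hξ
  have e2 := euler_two_deriv (s := s) hξ
  rw [show 3 - 2 * (2 - s) = 2 * s - 1 by ring, show 4 - 2 * (2 - s) = 2 * s by ring,
    show 2 - (2 - s) = s by ring, show 3 - (2 - s) = s + 1 by ring,
    show 2 - s + 1 = 3 - s by ring]
  -- For solutions f, g, h of one second order equation, W(g, h) f = W(f, h) g - W(f, g) h. Euler's
  -- transformation and its derivative turn the Wronskian at 2 - s into W(f, g).
  linear_combination -F s s 2 (1 - ξ) * wronskian_zero hs (mem_lens.1 hξ).1 +
    (1 - ξ) ^ 2 * F (2 - s) (2 - s) (3 - 2 * s) ξ *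
    (F s s (2 * s - 1) ξ * e2 - (s * F s s (2 * s - 1) ξ +
        ξ * (s * s / (2 * s - 1) * F (s + 1) (s + 1) (2 * s) ξ)) * e1)

end

/-! ### Holomorphy in the parameters, and the complement of the half-integers -/

theorem eventually_ne_neg_natCast {c : ℂ} (hc : ∀ k : ℕ, c ≠ -k) :
    ∀ᶠ w : ℂ in 𝓝 c, ∀ k : ℕ, w ≠ -k := by
  -- The excluded points are zeros of the entire function 1/Γ, so they stay away from c.
  have h : (Complex.Gamma c)⁻¹ ≠ 0 := inv_ne_zero (Complex.Gamma_ne_zero hc)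
  filter_upwards [Complex.differentiable_one_div_Gamma.continuous.continuousAt.eventually_ne h]
    with w hw k hk
  exact hw (by rw [hk, Complex.Gamma_neg_nat_eq_zero, inv_zero])

theorem differentiableAt_coeff {a b c : ℂ → ℂ} (ha : Differentiable ℂ a) (hb : Differentiable ℂ b)
    (hc : Differentiable ℂ c) {s : ℂ} (hs : ∀ k : ℕ, c s ≠ -k) (n : ℕ) :
    DifferentiableAt ℂ (fun s => coeff (a s) (b s) (c s) n) s := by
  have h (p : Polynomial ℂ) {f : ℂ → ℂ} (hf : Differentiable ℂ f) :
      DifferentiableAt ℂ (fun s => p.eval (f s)) s := p.differentiable.comp hf s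
  exact (((differentiableAt_const _).mul (h _ ha)).mul (h _ hb)).mul
    ((h _ hc).inv (ascPochhammer_eval_ne_zero hs n))

/-- The hypergeometric function is holomorphic in its parameters. -/
theorem differentiableAt_parameters {a b c : ℂ → ℂ} (ha : Differentiable ℂ a)
    (hb : Differentiable ℂ b) (hc : Differentiable ℂ c) {x s₀ : ℂ} (hx : ‖x‖ < 1)
    (hs₀ : ∀ k : ℕ, c s₀ ≠ -k) :
    DifferentiableAt ℂ (fun s => F (a s) (b s) (c s) x) s₀ := by
  set g : ℕ → ℂ → ℂ := fun n s => coeff (a s) (b s) (c s) n * x ^ n with hg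
  obtain ⟨q, hxq, hq1⟩ := exists_between hx
  have hq0 : 0 ≤ q := (norm_nonneg x).trans hxq.le
  -- The ratio of consecutive terms tends to x as n → ∞ and s → s₀ jointly. From some N on and near
  -- s₀ the terms are thus dominated by a geometric series of ratio q < 1, and the sum of the tail
  -- is holomorphic by Weierstrass.
  have hratio : Tendsto (fun p : ℕ × ℂ => (a p.2 + p.1) * (b p.2 + p.1) /
      ((c p.2 + p.1) * (p.1 + 1)) * x) (atTop ×ˢ 𝓝 s₀) (𝓝 x) := by
    have hinv : Tendsto (fun p : ℕ × ℂ => 1 / ((p.1 : ℂ) + 1)) (atTop ×ˢ 𝓝 s₀) (𝓝 0) :=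
      (tendsto_one_div_add_atTop_nhds_zero_nat (𝕜 := ℂ)).comp tendsto_fst
    have h (f : ℂ → ℂ) (hf : Differentiable ℂ f) : Tendsto (fun p : ℕ × ℂ =>
        1 + (f p.2 - 1) * (1 / ((p.1 : ℂ) + 1))) (atTop ×ˢ 𝓝 s₀) (𝓝 1) := by
      have := ((hf.continuous.tendsto s₀).comp
        (tendsto_snd (f := (atTop : Filter ℕ)) (g := 𝓝 s₀))).sub_const 1
      simpa using (this.mul hinv).const_add 1
    have := (((h a ha).mul (h b hb)).div (h c hc) one_ne_zero).mul_const x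
    rw [one_mul, div_one, one_mul] at this
    refine this.congr fun p => ?_
    have h3 : (p.1 : ℂ) + 1 ≠ 0 := Nat.cast_add_one_ne_zero p.1
    have e (y : ℂ) : 1 + (y - 1) * (1 / ((p.1 : ℂ) + 1)) = (y + p.1) / (p.1 + 1) := by
      field_simp; ring
    simp only [Pi.div_apply, e]
    congr 1
    by_cases h4 : c p.2 + p.1 = 0
    · simp [h4]
    · field_simp
  have hev := hratio.norm.eventually_lt_const hxq
  obtain ⟨P, hP, Q, hQ, hPQ⟩ := eventually_prod_iff.1 hev
  obtain ⟨N, hN⟩ := eventually_atTop.1 hP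
  have hgN : ∀ᶠ s in 𝓝 s₀, ‖g N s‖ < ‖g N s₀‖ + 1 :=
    (((differentiableAt_coeff ha hb hc hs₀ N).mul_const
      (x ^ N)).continuousAt.norm).eventually_lt_const (lt_add_one _)
  obtain ⟨U, hU, hUo, hsU⟩ := eventually_nhds_iff.1
    ((hQ.and hgN).and (hc.continuous.continuousAt.eventually (eventually_ne_neg_natCast hs₀)))
  have hbound : ∀ k : ℕ, ∀ s ∈ U, ‖g (k + N) s‖ ≤ (‖g N s₀‖ + 1) * q ^ k := by
    intro k
    induction k with
    | zero => intro s hs; simpa using (hU s hs).1.2.le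
    | succ k ih =>
      intro s hs
      have e : g (k + 1 + N) s = (a s + (k + N : ℕ)) * (b s + (k + N : ℕ)) /
          ((c s + (k + N : ℕ)) * ((k + N : ℕ) + 1)) * x * g (k + N) s := by
        rw [hg, show k + 1 + N = k + N + 1 by ring]
        beta_reduce
        rw [coefficient_succ (hU s hs).2]
        ring
      have h1 : _ < q := hPQ (hN (k + N) (Nat.le_add_left N k)) (hU s hs).1.1
      rw [e, norm_mul, pow_succ]
      calc _ ≤ q * ((‖g N s₀‖ + 1) * q ^ k) := by
            exact mul_le_mul h1.le (ih s hs) (norm_nonneg _) hq0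
        _ = _ := by ring
  have hdiff : ∀ n, DifferentiableOn ℂ (g n) U := fun n s hs =>
    ((differentiableAt_coeff ha hb hc (hU s hs).2 n).mul_const (x ^ n)).differentiableWithinAt
  have htail : DifferentiableOn ℂ (fun s => ∑' k, g (k + N) s) U :=
    Complex.differentiableOn_tsum_of_summable_norm
      ((summable_geometric_of_lt_one hq0 hq1).mul_left _) (fun k => hdiff (k + N)) hUo hbound
  have hF : (fun s => F (a s) (b s) (c s) x) =
      fun s => ∑ n ∈ Finset.range N, g n s + ∑' k, g (k + N) s := by
    funext s
    have h := hasSum (a s) (b s) (c s) hx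
    rw [h.summable.sum_add_tsum_nat_add N, h.tsum_eq]
  rw [hF]
  exact (DifferentiableAt.fun_sum fun n _ => (hdiff n).differentiableAt (hUo.mem_nhds hsU)).add
    (htail.differentiableAt (hUo.mem_nhds hsU))

/-- The complement of the half-integers. -/
def regularSet : Set ℂ := {s | ∀ n : ℤ, 2 * s ≠ n}

theorem regularSet_eq : regularSet = (Set.range fun n : ℤ => (n : ℂ) / 2)ᶜ := by
  ext s
  simp only [regularSet, Set.mem_ofPred_eq, Set.mem_compl_iff, Set.mem_range, not_exists]
  refine forall_congr' fun n => not_congr ?_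
  rw [div_eq_iff two_ne_zero, eq_comm, mul_comm]

/-- Removing a countable set from a real vector space of dimension at least two leaves it connected.
-/
theorem isPreconnected_regularSet : IsPreconnected regularSet := by
  rw [regularSet_eq]
  exact ((Set.countable_range _).isConnected_compl_of_one_lt_rank (by simp)).isPreconnected

theorem regularSet_eq_sin_ne_zero :
    regularSet = {s | Complex.sin (2 * s * Real.pi) ≠ 0} := by
  ext s
  simp only [regularSet, Set.mem_ofPred_eq, Ne, Complex.sin_eq_zero_iff, not_exists]
  refine forall_congr' fun n => not_congr ?_
  rw [mul_left_inj' (by exact_mod_cast Real.pi_ne_zero)]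

theorem isOpen_regularSet : IsOpen regularSet := by
  rw [regularSet_eq_sin_ne_zero]
  exact isOpen_ne_fun (by fun_prop) continuous_const

/-- Half-integers are the zeros of sin(2πs), which are isolated because this function is 1 at s =
1/4. -/
theorem eventually_mem_regularSet (s₀ : ℂ) : ∀ᶠ s in 𝓝[≠] s₀, s ∈ regularSet := by
  have han : AnalyticOnNhd ℂ (fun s : ℂ => Complex.sin (2 * s * Real.pi)) Set.univ :=
    fun s _ => (Differentiable.analyticAt (by fun_prop) s)
  rw [regularSet_eq_sin_ne_zero]
  refine (han s₀ trivial).eventually_eq_zero_or_eventually_ne_zero.resolve_left fun h0 => ?_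
  have := han.eqOn_zero_of_preconnected_of_eventuallyEq_zero isPreconnected_univ trivial h0
    (Set.mem_univ (1 / 4 : ℂ))
  simp only [Pi.zero_apply, Complex.sin_eq_zero_iff] at this
  obtain ⟨k, hk⟩ := this
  rw [mul_left_inj' (by exact_mod_cast Real.pi_ne_zero)] at hk
  have h2 : ((2 * k : ℤ) : ℂ) = ((1 : ℤ) : ℂ) := by push_cast; linear_combination -2 * hk
  have := Int.cast_injective h2
  omega

theorem differentiableOn_regularWronskian :
    DifferentiableOn ℂ (fun s => regularWronskian s (1 / 2)) regularSet := by
  intro s hs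
  have h3 := three_sub_two_mul_ne hs
  have h3' : 3 - 2 * s ≠ 0 := by simpa using h3 0
  have h4 : ∀ k : ℕ, 4 - 2 * s ≠ -k := by
    intro k hk
    refine three_sub_two_mul_ne hs (k + 1) ?_
    push_cast
    linear_combination hk
  have hn : ‖(1 / 2 : ℂ)‖ < 1 := (mem_lens.1 half_mem_lens).1
  have hn' : ‖1 - (1 / 2 : ℂ)‖ < 1 := (mem_lens.1 half_mem_lens).2
  have h3n : ∀ k : ℕ, (3 : ℂ) ≠ -k := by
    intro k hk
    refine two_ne_neg_natCast (k + 1) ?_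
    push_cast
    linear_combination hk
  have d1 := differentiableAt_parameters (a := fun s => s) (b := fun s => s) (c := fun _ => 2)
    (by fun_prop) (by fun_prop) (by fun_prop) (s₀ := s) hn' two_ne_neg_natCast
  have d2 := differentiableAt_parameters (a := fun s => s + 1) (b := fun s => s + 1)
    (c := fun _ => 3) (by fun_prop) (by fun_prop) (by fun_prop) (s₀ := s) hn' h3n
  have d3 := differentiableAt_parameters (a := fun s => 2 - s) (b := fun s => 2 - s)
    (c := fun s => 3 - 2 * s) (by fun_prop) (by fun_prop) (by fun_prop) (s₀ := s) hn h3
  have d4 := differentiableAt_parameters (a := fun s => 3 - s) (b := fun s => 3 - s)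
    (c := fun s => 4 - 2 * s) (by fun_prop) (by fun_prop) (by fun_prop) (s₀ := s) hn h4
  refine DifferentiableAt.differentiableWithinAt ?_
  unfold regularWronskian
  fun_prop (disch := assumption)

/-! ### Gauss's sum and the value of the connection coefficient -/

theorem one_ne_neg_natCast (k : ℕ) : (1 : ℂ) ≠ -k := by
  intro h
  have : ((1 + k : ℕ) : ℂ) = 0 := by push_cast; rw [h]; ring
  rw [Nat.cast_eq_zero] at this
  omega

/-- The binomial series. -/
theorem hasSum_binomial (s : ℂ) {z : ℂ} (hz : ‖z‖ < 1) :
    HasSum (fun n => coeff s 1 1 n * z ^ n) ((1 - z) ^ (-s)) := by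
  have h := hasSum s 1 1 hz
  have h0 : F (1 - s) 0 1 z = 1 := by
    refine (hasSum (1 - s) 0 1 hz).unique ?_
    convert hasSum_ite_eq (0 : ℕ) (1 : ℂ) using 2 with n
    rcases n with _ | n
    · simp [coefficient_zero]
    · simp [coeff, ordinaryHypergeometricCoefficient,
        ascPochhammer_succ_left]
  -- Euler's transformation with b = c = 1 leaves F(1 - s, 0; 1; z) = 1 as the other factor.
  have e := euler (a := s) (b := 1) one_ne_neg_natCast hz
  rw [sub_self, h0, mul_one, show 1 - s - 1 = -s by ring] at e
  rwa [← e]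

/-- Nonnegative coefficients make the binomial series, for t in (0, 1), its own dominating series in
Gauss's sum. -/
theorem exists_coeff_eq_ofReal {σ : ℝ} (hσ : 0 < σ) (n : ℕ) :
    ∃ r : ℝ, 0 ≤ r ∧ coeff σ 1 1 n = r := by
  induction n with
  | zero => exact ⟨1, zero_le_one, by simp [coefficient_zero]⟩
  | succ n ih =>
    obtain ⟨r, hr, h⟩ := ih
    refine ⟨(σ + n) * (1 + n) / ((1 + n) * (n + 1)) * r, by positivity, ?_⟩
    rw [coefficient_succ one_ne_neg_natCast, h]
    push_cast
    rfl

/-- **Gauss's summation theorem** for `F(σ, σ; 2; 1)`. -/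
theorem hasSum_gauss {σ : ℝ} (h0 : 0 < σ) (h1 : σ < 1) :
    HasSum (fun n => coeff σ σ 2 n)
      (Complex.Gamma (2 - 2 * σ) / Complex.Gamma (2 - σ) ^ 2) := by
  set s : ℂ := (σ : ℂ) with hs
  choose r hr0 hr using exists_coeff_eq_ofReal h0
  have hΓ : Complex.Gamma s ≠ 0 := Complex.Gamma_ne_zero_of_re_pos (by simpa [hs])
  have hΓ2 : Complex.Gamma (2 - s) ≠ 0 :=
    Complex.Gamma_ne_zero_of_re_pos (by simp [hs]; linarith)
  -- Beta weight: ∫ t^n w = B(s + n, 2 - s) turns the binomial coefficients into those of F(s, s; 2;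
  -- 1), up to Γ(s)Γ(2 - s). Summing first gives (1 - t)^(-s) w, whose integral is B(s, 2 - 2s).
  set w : ℝ → ℂ := fun t => (t : ℂ) ^ (s - 1) * (1 - (t : ℂ)) ^ (2 - s - 1) with hw
  have hsn : ∀ n : ℕ, s + n ≠ 0 := by
    intro n h
    have : ((σ + n : ℝ) : ℂ) = 0 := by push_cast; exact h
    rw [Complex.ofReal_eq_zero] at this
    have : (0 : ℝ) ≤ n := n.cast_nonneg
    linarith
  have hn2 : ∀ n : ℕ, (n : ℂ) + 2 ≠ 0 := by
    intro n
    exact_mod_cast (by omega : n + 2 ≠ 0)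
  have hcoef : ∀ n, coeff s 1 1 n * Complex.betaIntegral (s + n) (2 - s) =
      coeff s s 2 n * (Complex.Gamma s * Complex.Gamma (2 - s)) := by
    intro n
    have hG := Complex.Gamma_mul_Gamma_eq_betaIntegral (s := s + n) (t := 2 - s)
      (by simp [hs]; positivity) (by simp [hs]; linarith)
    have hG2 : Complex.Gamma (n + 2) ≠ 0 :=
      Complex.Gamma_ne_zero_of_re_pos (by simp; positivity)
    rw [show s + n + (2 - s) = n + 2 by ring] at hG
    have key : coeff s 1 1 n * Complex.Gamma (s + n) =
        coeff s s 2 n * Complex.Gamma s * Complex.Gamma (n + 2) := by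
      clear hG hG2
      induction n with
      | zero => simp [coefficient_zero, show (2 : ℂ) = 1 + 1 by norm_num,
          Complex.Gamma_add_one]
      | succ n ih =>
        have h3 : (n : ℂ) + 1 ≠ 0 := Nat.cast_add_one_ne_zero n
        rw [coefficient_succ one_ne_neg_natCast, coefficient_succ two_ne_neg_natCast]
        push_cast
        rw [← add_assoc, Complex.Gamma_add_one _ (hsn n),
          show (n : ℂ) + 1 + 2 = n + 2 + 1 by ring, Complex.Gamma_add_one _ (hn2 n)]
        have h4 : (2 : ℂ) + n ≠ 0 := by rw [add_comm]; exact hn2 n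
        have h5 : (1 : ℂ) + n ≠ 0 := by rw [add_comm]; exact h3
        calc _ = (s + n) * (s + n) / (n + 1) * (coeff s 1 1 n * Complex.Gamma (s + n)) := by
              field_simp
          _ = _ := by rw [ih]; field_simp; ring
    refine mul_left_cancel₀ hG2 ?_
    linear_combination -coeff s 1 1 n * hG + Complex.Gamma (2 - s) * key
  have hbin : ∀ t : ℝ, 0 < t → t < 1 → HasSum (fun n => ((r n * t ^ n : ℝ) : ℂ))
      ((1 - (t : ℂ)) ^ (-s)) := by
    intro t ht0 ht1
    have := hasSum_binomial s (z := t) (by simpa [abs_of_pos ht0])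
    refine this.congr_fun fun n => ?_
    rw [hr]
    push_cast
    rfl
  have hbin' : ∀ t : ℝ, 0 < t → t < 1 →
      HasSum (fun n => r n * t ^ n * ‖w t‖) ‖(1 - (t : ℂ)) ^ (-s) * w t‖ := by
    intro t ht0 ht1
    have hsum := hbin t ht0 ht1
    have hsm : Summable fun n => r n * t ^ n := Complex.summable_ofReal.1 hsum.summable
    have e : (1 - (t : ℂ)) ^ (-s) = ((∑' n, r n * t ^ n : ℝ) : ℂ) := by
      rw [Complex.ofReal_tsum, hsum.tsum_eq]
    rw [e, norm_mul _ (w t), Complex.norm_real,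
      Real.norm_of_nonneg (tsum_nonneg fun n => mul_nonneg (hr0 n) (by positivity))]
    exact hsm.hasSum.mul_right _
  have hprod : ∀ t : ℝ, t < 1 → (1 - (t : ℂ)) ^ (-s) * w t =
      (t : ℂ) ^ (s - 1) * (1 - (t : ℂ)) ^ (2 - 2 * s - 1) := by
    intro t ht1
    have hne : 1 - (t : ℂ) ≠ 0 := by
      rw [← Complex.ofReal_one, ← Complex.ofReal_sub, Complex.ofReal_ne_zero]; linarith
    rw [hw]
    beta_reduce
    rw [mul_left_comm, ← Complex.cpow_add _ _ hne]
    congr 2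
    ring
  have hae : ∀ᵐ t : ℝ, t ∈ Set.uIoc (0 : ℝ) 1 → 0 < t ∧ t < 1 := by
    filter_upwards [Measure.ae_ne volume (1 : ℝ)] with t ht hmem
    rw [Set.uIoc_of_le zero_le_one] at hmem
    exact ⟨hmem.1, lt_of_le_of_ne hmem.2 ht⟩
  have hre : 0 < (2 - 2 * s).re := by simp [hs]; linarith
  have hint := Complex.betaIntegral_convergent (u := s) (v := 2 - 2 * s) (by simpa [hs]) hre
  have hwm : Measurable w := by
    rw [hw]
    exact (Complex.measurable_ofReal.pow_const _).mul
      ((measurable_const.sub Complex.measurable_ofReal).pow_const _)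
  suffices main : HasSum (fun n : ℕ => ∫ t in (0 : ℝ)..1, ((r n * t ^ n : ℝ) : ℂ) * w t)
      (∫ t in (0 : ℝ)..1, (t : ℂ) ^ (s - 1) * (1 - (t : ℂ)) ^ (2 - 2 * s - 1)) by
    have hΓ3 := Complex.Gamma_mul_Gamma_eq_betaIntegral (s := s) (t := 2 - 2 * s)
      (by simpa [hs]) hre
    rw [show s + (2 - 2 * s) = 2 - s by ring] at hΓ3
    have e : Complex.Gamma (2 - 2 * s) / Complex.Gamma (2 - s) ^ 2 =
        (∫ t in (0 : ℝ)..1, (t : ℂ) ^ (s - 1) * (1 - (t : ℂ)) ^ (2 - 2 * s - 1)) /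
          (Complex.Gamma s * Complex.Gamma (2 - s)) := by
      change _ = Complex.betaIntegral s (2 - 2 * s) / _
      rw [div_eq_div_iff (by positivity) (mul_ne_zero hΓ hΓ2)]
      linear_combination Complex.Gamma (2 - s) * hΓ3
    rw [e]
    refine (main.div_const _).congr_fun fun n => ?_
    rw [eq_div_iff (mul_ne_zero hΓ hΓ2), ← hcoef, Complex.betaIntegral,
      ← intervalIntegral.integral_const_mul]
    refine intervalIntegral.integral_congr_ae ?_
    filter_upwards [hae] with t ht hmem
    have ht0 : (t : ℂ) ≠ 0 := Complex.ofReal_ne_zero.2 (ht hmem).1.ne'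
    rw [hr, hw]
    push_cast
    rw [add_sub_right_comm, Complex.cpow_add _ _ ht0, Complex.cpow_natCast]
    ring
  refine intervalIntegral.hasSum_integral_of_dominated_convergence
    (fun n t => r n * t ^ n * ‖w t‖) ?_ ?_ ?_ ?_ ?_
  · exact fun n => ((by fun_prop : Measurable fun t : ℝ => ((r n * t ^ n : ℝ) : ℂ)).mul
      hwm).aestronglyMeasurable
  · intro n
    filter_upwards [hae] with t ht hmem
    have := mul_nonneg (hr0 n) (pow_nonneg (ht hmem).1.le n)
    rw [norm_mul, Complex.norm_real, Real.norm_of_nonneg this]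
  · filter_upwards [hae] with t ht hmem
    exact (hbin' t (ht hmem).1 (ht hmem).2).summable
  · refine hint.norm.congr_ae ?_
    rw [Filter.EventuallyEq, ae_restrict_iff' measurableSet_uIoc]
    filter_upwards [hae] with t ht hmem
    rw [(hbin' t (ht hmem).1 (ht hmem).2).tsum_eq, hprod t (ht hmem).2]
  · filter_upwards [hae] with t ht hmem
    rw [← hprod t (ht hmem).2]
    exact (hbin t (ht hmem).1 (ht hmem).2).mul_right (w t)

/-- The connection coefficient. -/
noncomputable def connectionCoeff (s : ℂ) : ℂ :=
  Complex.Gamma (2 - 2 * s) / Complex.Gamma (2 - s) ^ 2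

/-- Let ξ → 0+ in `connection_wronskian`. The left side converges by Abel's theorem and Gauss's sum;
the term with ξ^(2-2σ) disappears because 2 - 2σ > 0. The interval (0, 1/2) contains no
half-integer. -/
theorem regularWronskian_ofReal {σ : ℝ} (h0 : 0 < σ) (h1 : σ < 1 / 2) :
    regularWronskian σ (1 / 2) = (2 - 2 * σ) * connectionCoeff σ := by
  have hs : ∀ n : ℤ, 2 * (σ : ℂ) ≠ n := by
    intro n hn
    have : ((2 * σ : ℝ) : ℂ) = ((n : ℝ) : ℂ) := by push_cast; exact hn
    have := Complex.ofReal_injective this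
    have h2 : (0 : ℝ) < n := by linarith
    have h3 : (n : ℝ) < 1 := by linarith
    norm_cast at h2 h3
    omega
  have hlim : Tendsto (fun ξ : ℝ => F σ σ 2 (1 - ξ)) (𝓝[>] 0) (𝓝 (connectionCoeff σ)) := by
    have h := Complex.tendsto_tsum_powerSeries_nhdsWithin_lt
      (hasSum_gauss h0 (by linarith)).tendsto_sum_nat
    rw [tendsto_map'_iff] at h
    have h' : Tendsto (fun ξ : ℝ => 1 - ξ) (𝓝[>] 0) (𝓝[<] 1) := by
      refine tendsto_nhdsWithin_iff.2 ⟨?_, ?_⟩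
      · exact ((continuous_const.sub continuous_id).tendsto' (0 : ℝ) 1 (by simp)).mono_left
          nhdsWithin_le_nhds
      · filter_upwards [self_mem_nhdsWithin] with ξ hξ
        simp only [Set.mem_Ioi] at hξ
        simpa using hξ
    refine (h.comp h').congr' ?_
    filter_upwards [Ioo_mem_nhdsGT (zero_lt_one' ℝ)] with ξ hξ
    have : ‖1 - (ξ : ℂ)‖ < 1 := by
      rw [← Complex.ofReal_one, ← Complex.ofReal_sub, Complex.norm_real, Real.norm_eq_abs,
        abs_lt]
      constructor <;> linarith [hξ.1, hξ.2]
    simp [(hasSum σ σ 2 this).tsum_eq]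
  have hpow : Tendsto (fun ξ : ℝ => (ξ : ℂ) ^ (2 - 2 * (σ : ℂ))) (𝓝[>] 0) (𝓝 0) := by
    have : ContinuousAt (fun ξ : ℝ => (ξ : ℂ) ^ (2 - 2 * (σ : ℂ))) 0 :=
      Complex.continuousAt_ofReal_cpow_const 0 _ (Or.inl (by simp; linarith))
    have h := this.tendsto
    rw [Complex.ofReal_zero, Complex.zero_cpow] at h
    · exact h.mono_left nhdsWithin_le_nhds
    · have := hs 2
      push_cast at this
      rw [sub_ne_zero]
      exact this.symm
  have hser : ∀ a b c : ℂ, Tendsto (fun ξ : ℝ => F a b c ξ) (𝓝[>] 0) (𝓝 1) := by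
    intro a b c
    have h1 : ContinuousAt (F a b c) ((0 : ℝ) : ℂ) := (analyticAt a b c (by simp)).continuousAt
    have h2 := (ContinuousAt.comp (f := Complex.ofReal) (x := (0 : ℝ)) h1
      Complex.continuous_ofReal.continuousAt).tendsto
    simp only [Function.comp_apply, Complex.ofReal_zero, ordinaryHypergeometric_zero] at h2
    exact h2.mono_left nhdsWithin_le_nhds
  have hl := hlim.const_mul (2 - 2 * (σ : ℂ))
  have hr := ((hser σ σ (2 * σ - 1)).const_mul (regularWronskian σ (1 / 2))).sub
    ((hpow.mul (hser (2 - σ) (2 - σ) (3 - 2 * σ))).const_mul (regularWronskian (2 - σ) (1 / 2)))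
  rw [zero_mul, mul_zero, sub_zero, mul_one] at hr
  refine (tendsto_nhds_unique (hl.congr' ?_) hr).symm
  filter_upwards [Ioo_mem_nhdsGT (zero_lt_one' ℝ)] with ξ hξ
  refine connection_wronskian hs (mem_lens.2 ⟨?_, ?_⟩)
  · rw [Complex.norm_real, Real.norm_eq_abs, abs_lt]
    constructor <;> linarith [hξ.1, hξ.2]
  · rw [← Complex.ofReal_one, ← Complex.ofReal_sub, Complex.norm_real, Real.norm_eq_abs, abs_lt]
    constructor <;> linarith [hξ.1, hξ.2]

/-- Both sides are holomorphic on the connected set `regularSet` and agree on a real interval around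
1/4. -/
theorem regularWronskian_eq_connectionCoeff {s : ℂ} (hs : s ∈ regularSet) :
    regularWronskian s (1 / 2) = (2 - 2 * s) * connectionCoeff s := by
  have hA : DifferentiableOn ℂ (fun s => (2 - 2 * s) * connectionCoeff s) regularSet := by
    intro s hs
    have h1 : DifferentiableAt ℂ (fun s => Complex.Gamma (2 - 2 * s)) s := by
      refine (Complex.differentiableAt_Gamma (2 - 2 * s) fun m hm => hs (2 + m) ?_).comp s
        (by fun_prop)
      push_cast
      linear_combination -hm
    have h2 : DifferentiableAt ℂ (fun s => (Complex.Gamma (2 - s))⁻¹) s :=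
      Complex.differentiable_one_div_Gamma.differentiableAt.comp s (by fun_prop)
    have h3 : (fun s => (2 - 2 * s) * connectionCoeff s) =
        fun s => (2 - 2 * s) * (Complex.Gamma (2 - 2 * s) * (Complex.Gamma (2 - s))⁻¹ ^ 2) := by
      funext s
      rw [connectionCoeff, inv_pow, div_eq_mul_inv]
    rw [h3]
    exact (by fun_prop : DifferentiableAt ℂ _ s).differentiableWithinAt
  have h4 : (((1 / 4 : ℝ) : ℂ)) ∈ regularSet := by
    intro n hn
    have : ((1 : ℤ) : ℂ) = ((2 * n : ℤ) : ℂ) := by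
      push_cast at hn ⊢
      linear_combination 2 * hn
    have := Int.cast_injective this
    omega
  refine (differentiableOn_regularWronskian.analyticOnNhd
    isOpen_regularSet).eqOn_of_preconnected_of_frequently_eq (hA.analyticOnNhd isOpen_regularSet)
    isPreconnected_regularSet h4 ?_ hs
  have hmap : Tendsto (fun t : ℝ => (t : ℂ)) (𝓝[≠] (1 / 4)) (𝓝[≠] ((1 / 4 : ℝ) : ℂ)) := by
    refine tendsto_nhdsWithin_iff.2 ⟨Complex.continuous_ofReal.continuousAt.tendsto.mono_left
      nhdsWithin_le_nhds, ?_⟩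
    filter_upwards [self_mem_nhdsWithin] with t ht h
    exact ht (Complex.ofReal_injective h)
  refine hmap.frequently (Eventually.frequently ?_)
  filter_upwards [eventually_nhdsWithin_of_eventually_nhds
    (Ioo_mem_nhds (by norm_num : (0 : ℝ) < 1 / 4) (by norm_num : (1 / 4 : ℝ) < 1 / 2))] with t ht
  exact regularWronskian_ofReal ht.1 ht.2

/-- The connection formula between the solutions at `ξ = 1` and at `ξ = 0`. -/
theorem connection {s : ℂ} (hs : s ∈ regularSet) {ξ : ℂ} (hξ : ξ ∈ lens) :
    ξ ^ s * F s s 2 (1 - ξ) = connectionCoeff s * (ξ ^ s * F s s (2 * s - 1) ξ) +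
      connectionCoeff (2 - s) * (ξ ^ (2 - s) * F (2 - s) (2 - s) (3 - 2 * s) ξ) := by
  have h := connection_wronskian hs hξ
  rw [regularWronskian_eq_connectionCoeff hs,
    regularWronskian_eq_connectionCoeff (two_mul_two_sub_ne hs)] at h
  have hne : 2 - 2 * s ≠ 0 := by
    rw [sub_ne_zero]
    exact (by simpa using hs 2 : 2 * s ≠ 2).symm
  have hpow : ξ ^ (2 - s) = ξ ^ s * ξ ^ (2 - 2 * s) := by
    rw [← Complex.cpow_add _ _ (Complex.slitPlane_ne_zero (lens_subset_slitPlane hξ))]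
    congr 1
    ring
  rw [hpow]
  refine mul_left_cancel₀ hne ?_
  linear_combination ξ ^ s * h

end Hypergeometric

namespace Siegel

open scoped ENNReal

/-! ### Polar coordinates on the boundary and the Cayley transform -/

/-- Polar coordinates in the plane, with the half squared radius as radial coordinate. -/
theorem lintegral_eq_lintegral_half_sq {G : ℂ → ℝ≥0∞} (hG : Measurable G) :
    ∫⁻ w, G w = ∫⁻ q in Set.Ioi (0 : ℝ), ∫⁻ θ in Set.Ioo (-Real.pi) Real.pi,
      G (Real.sqrt (2 * q) * Complex.exp (θ * Complex.I)) := by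
  have himage : (fun r : ℝ => r ^ 2 / 2) '' Set.Ioi 0 = Set.Ioi 0 := by
    ext q
    simp only [Set.mem_image, Set.mem_Ioi]
    constructor
    · rintro ⟨r, hr, rfl⟩; positivity
    · intro hq
      refine ⟨Real.sqrt (2 * q), by positivity, ?_⟩
      rw [Real.sq_sqrt (by positivity)]; ring
  have hinj : Set.InjOn (fun r : ℝ => r ^ 2 / 2) (Set.Ioi 0) := by
    intro x hx y hy hxy
    simp only [Set.mem_Ioi] at hx hy
    have : x ^ 2 = y ^ 2 := by simpa using hxy
    exact (pow_left_inj₀ hx.le hy.le two_ne_zero).1 this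
  have hderiv : ∀ x ∈ Set.Ioi (0 : ℝ),
      HasDerivWithinAt (fun r : ℝ => r ^ 2 / 2) x (Set.Ioi 0) x := by
    intro x _
    refine (((hasDerivAt_pow 2 x).div_const 2).congr_deriv ?_).hasDerivWithinAt
    simp
  conv_rhs => rw [← himage]
  rw [lintegral_image_eq_lintegral_abs_deriv_mul measurableSet_Ioi hderiv hinj,
    ← Complex.lintegral_comp_polarCoord_symm, polarCoord_target, Measure.volume_eq_prod,
    ← Measure.prod_restrict, lintegral_prod]
  · refine setLIntegral_congr_fun measurableSet_Ioi fun r hr => ?_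
    simp only [Set.mem_Ioi] at hr
    simp only [smul_eq_mul]
    rw [lintegral_const_mul' _ _ ENNReal.ofReal_ne_top, abs_of_pos hr]
    congr 1
    refine lintegral_congr fun θ => ?_
    rw [mul_div_cancel₀ _ (two_ne_zero' ℝ), Real.sqrt_sq hr.le, Complex.polarCoord_symm_apply,
      Complex.exp_mul_I, Complex.ofReal_cos, Complex.ofReal_sin]
  · have : Measurable fun p : ℝ × ℝ => Complex.polarCoord.symm p := by
      simp only [Complex.polarCoord_symm_apply]
      fun_prop
    exact (Measurable.mul (by fun_prop) (hG.comp this)).aemeasurable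

/-- The half plane variable is m = |w|²/2 + iv, the first coordinate of the boundary point. No
density appears, because r dr = d(r²/2). -/
theorem lintegral_eq_lintegral_halfPlane {g : ℂ × ℝ → ℝ≥0∞} (hg : Measurable g) :
    ∫⁻ p, g p = ∫⁻ m in {m : ℂ | 0 < m.re}, ∫⁻ θ in Set.Ioo (-Real.pi) Real.pi,
      g (Real.sqrt (2 * m.re) * Complex.exp (θ * Complex.I), m.im) := by
  have hmeas : Measurable fun x : ℝ × ℝ => ∫⁻ θ in Set.Ioo (-Real.pi) Real.pi,
      g (Real.sqrt (2 * x.1) * Complex.exp (θ * Complex.I), x.2) := by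
    refine Measurable.lintegral_prod_right' (f := fun x : (ℝ × ℝ) × ℝ =>
      g (Real.sqrt (2 * x.1.1) * Complex.exp (x.2 * Complex.I), x.1.2)) (hg.comp ?_)
    fun_prop
  have hpre : {m : ℂ | 0 < m.re} = Complex.measurableEquivRealProd ⁻¹'
      (Set.Ioi (0 : ℝ) ×ˢ Set.univ) := by
    ext m; simp
  rw [hpre]
  refine Eq.trans ?_ (((Complex.volume_preserving_equiv_real_prod.restrict_preimage_emb
    Complex.measurableEquivRealProd.measurableEmbedding _).lintegral_comp_emb
    Complex.measurableEquivRealProd.measurableEmbedding fun x =>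
      ∫⁻ θ in Set.Ioo (-Real.pi) Real.pi,
        g (Real.sqrt (2 * x.1) * Complex.exp (θ * Complex.I), x.2)).symm)
  rw [Measure.volume_eq_prod, Measure.volume_eq_prod, ← Measure.prod_restrict,
    Measure.restrict_univ, lintegral_prod_symm _ hg.aemeasurable,
    lintegral_prod_symm _ hmeas.aemeasurable]
  exact lintegral_congr fun v => lintegral_eq_lintegral_half_sq (hg.comp (by fun_prop))

/-- The real Jacobian of a holomorphic map is |f'|²; the determinant of multiplication by z is the
field norm of ℂ over ℝ. -/
theorem det_mul_left (z : ℂ) :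
    (((ContinuousLinearMap.mul ℂ ℂ z).restrictScalars ℝ : ℂ →L[ℝ] ℂ)).det = ‖z‖ ^ 2 := by
  rw [← Complex.normSq_eq_norm_sq, ← Algebra.norm_complex_apply, Algebra.norm_apply]
  rfl

/-- The Cayley transform maps the unit disc onto the right half plane. -/
noncomputable def cayley (a : ℝ) (ζ : ℂ) : ℂ := a * (1 - ζ) / (1 + ζ)

theorem one_add_ne_zero {ζ : ℂ} (hζ : ‖ζ‖ < 1) : 1 + ζ ≠ 0 :=
  Complex.slitPlane_ne_zero (Complex.mem_slitPlane_of_norm_lt_one hζ)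

theorem cayley_re {a : ℝ} {ζ : ℂ} :
    (cayley a ζ).re = a * (1 - ‖ζ‖ ^ 2) / ‖1 + ζ‖ ^ 2 := by
  rw [cayley, Complex.div_re, ← add_div, ← Complex.normSq_eq_norm_sq, ← Complex.normSq_eq_norm_sq]
  congr 1
  simp [Complex.normSq_apply]
  ring

theorem add_cayley {a : ℝ} {ζ : ℂ} (hζ : ‖ζ‖ < 1) : a + cayley a ζ = 2 * a / (1 + ζ) := by
  have := one_add_ne_zero hζ
  rw [cayley]
  field_simp
  ring

theorem cayley_image {a : ℝ} (ha : 0 < a) :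
    cayley a '' Metric.ball 0 1 = {m : ℂ | 0 < m.re} := by
  have ha' : (a : ℂ) ≠ 0 := Complex.ofReal_ne_zero.2 ha.ne'
  ext m
  simp only [Set.mem_image, mem_ball_zero_iff, Set.mem_ofPred_eq]
  constructor
  · rintro ⟨ζ, hζ, rfl⟩
    have := one_add_ne_zero hζ
    rw [cayley_re]
    have : 0 < 1 - ‖ζ‖ ^ 2 := by nlinarith [norm_nonneg ζ]
    positivity
  · intro hm
    have h0 : (a : ℂ) + m ≠ 0 := by
      intro h
      have := congrArg Complex.re h
      simp at this
      linarith
    refine ⟨(a - m) / (a + m), ?_, ?_⟩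
    · rw [norm_div, div_lt_one (norm_pos_iff.2 h0), ← sq_lt_sq₀ (norm_nonneg _) (norm_nonneg _),
        ← Complex.normSq_eq_norm_sq, ← Complex.normSq_eq_norm_sq, Complex.normSq_apply,
        Complex.normSq_apply]
      simp
      nlinarith
    · have h1 : 1 + (a - m) / (a + m) = 2 * a / (a + m) := by field_simp; ring
      have h2 : 1 - (a - m) / (a + m) = 2 * m / (a + m) := by field_simp; ring
      rw [cayley, h1, h2]
      field_simp

theorem cayley_injOn {a : ℝ} (ha : 0 < a) : Set.InjOn (cayley a) (Metric.ball 0 1) := by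
  intro x hx y hy hxy
  rw [mem_ball_zero_iff] at hx hy
  have ha' : (a : ℂ) ≠ 0 := Complex.ofReal_ne_zero.2 ha.ne'
  have hx0 := one_add_ne_zero hx
  have hy0 := one_add_ne_zero hy
  have h : 2 * (a : ℂ) / (1 + x) = 2 * a / (1 + y) := by
    rw [← add_cayley hx, ← add_cayley hy, hxy]
  rw [div_eq_div_iff hx0 hy0] at h
  have := mul_left_cancel₀ (mul_ne_zero two_ne_zero ha') h
  exact (add_left_cancel this).symm

theorem hasDerivAt_cayley (a : ℝ) {ζ : ℂ} (hζ : ‖ζ‖ < 1) :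
    HasDerivAt (cayley a) (-2 * a / (1 + ζ) ^ 2) ζ := by
  have h0 := one_add_ne_zero hζ
  refine ((((hasDerivAt_id ζ).const_sub 1).const_mul (a : ℂ)).div
    ((hasDerivAt_id ζ).const_add 1) h0).congr_deriv ?_
  simp only [id_eq]
  congr 1
  ring

theorem lintegral_halfPlane_eq_lintegral_disc {a : ℝ} (ha : 0 < a) (K : ℂ → ℝ≥0∞) :
    ∫⁻ m in {m : ℂ | 0 < m.re}, K m = ∫⁻ ζ in Metric.ball (0 : ℂ) 1,
      ENNReal.ofReal ((2 * a) ^ 2 / ‖1 + ζ‖ ^ 4) * K (cayley a ζ) := by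
  rw [← cayley_image ha, lintegral_image_eq_lintegral_abs_det_fderiv_mul volume
    measurableSet_ball (f' := fun ζ =>
      ((ContinuousLinearMap.mul ℂ ℂ (-2 * a / (1 + ζ) ^ 2)).restrictScalars ℝ : ℂ →L[ℝ] ℂ)) ?_
    (cayley_injOn ha)]
  · refine setLIntegral_congr_fun measurableSet_ball fun ζ hζ => ?_
    simp only [det_mul_left]
    congr 2
    rw [abs_of_nonneg (by positivity)]
    simp [abs_of_pos ha]
    ring
  · intro ζ hζ
    rw [mem_ball_zero_iff] at hζ
    have h := ((hasDerivAt_cayley a hζ).hasFDerivAt.restrictScalars ℝ).hasFDerivWithinAt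
      (s := Metric.ball 0 1)
    convert h using 1
    ext
    simp [mul_comm]

/-! ### Moments of a linear form on the sphere -/

theorem integral_exp_int_mul (n : ℤ) :
    ∫ θ in Set.Ioo (-Real.pi) Real.pi, Complex.exp (n * (θ * Complex.I)) =
      if n = 0 then 2 * (Real.pi : ℂ) else 0 := by
  rw [← integral_Ioc_eq_integral_Ioo,
    ← intervalIntegral.integral_of_le (by linarith [Real.pi_pos])]
  split_ifs with h
  · simp [h]
    ring
  · have hc : (n : ℂ) * Complex.I ≠ 0 := mul_ne_zero (Int.cast_ne_zero.2 h) Complex.I_ne_zero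
    have h1 := integral_exp_mul_complex (a := -Real.pi) (b := Real.pi) hc
    have h2 : Complex.exp (n * Complex.I * Real.pi) = Complex.exp (n * Complex.I * (-Real.pi : ℝ)) := by
      rw [Complex.exp_eq_exp_iff_exists_int]
      exact ⟨n, by push_cast; ring⟩
    rw [h2, sub_self, zero_div] at h1
    rw [← h1]
    exact intervalIntegral.integral_congr fun θ _ => by ring_nf

theorem integral_pow_mul_one_sub_sq_pow (k j : ℕ) :
    ∫ r in (0 : ℝ)..1, r ^ (2 * k + 1) * (1 - r ^ 2) ^ j =
      (k.factorial * j.factorial / (2 * (k + j + 1).factorial) : ℝ) := by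
  induction j generalizing k with
  | zero =>
    simp only [pow_zero, mul_one, integral_pow, one_pow, Nat.factorial_zero, Nat.cast_one,
      add_zero, Nat.factorial_succ]
    have : (k.factorial : ℝ) ≠ 0 := Nat.cast_ne_zero.2 k.factorial_ne_zero
    push_cast
    rw [zero_pow (by omega)]
    field_simp
    ring
  | succ j ih =>
    have h : ∀ r : ℝ, r ^ (2 * k + 1) * (1 - r ^ 2) ^ (j + 1) =
        r ^ (2 * k + 1) * (1 - r ^ 2) ^ j - r ^ (2 * (k + 1) + 1) * (1 - r ^ 2) ^ j := by
      intro r; ring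
    simp only [h]
    rw [intervalIntegral.integral_sub (Continuous.intervalIntegrable (by fun_prop) _ _)
      (Continuous.intervalIntegrable (by fun_prop) _ _), ih, ih,
      show k + 1 + j + 1 = k + j + 1 + 1 by ring, show k + (j + 1) + 1 = k + j + 1 + 1 by ring,
      Nat.factorial_succ (k + j + 1), Nat.factorial_succ k, Nat.factorial_succ j]
    have : ((k + j + 1).factorial : ℝ) ≠ 0 := Nat.cast_ne_zero.2 (Nat.factorial_ne_zero _)
    push_cast
    field_simp
    ring

/-- The angular integral kills k ≠ l, and the radial one is a Beta integral. -/
theorem integral_disc (k l j : ℕ) :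
    ∫ ζ in Metric.ball (0 : ℂ) 1, ζ ^ k * starRingEnd ℂ ζ ^ l * ((1 - ‖ζ‖ ^ 2 : ℝ) : ℂ) ^ j =
      if k = l then (Real.pi : ℂ) * (k.factorial * j.factorial / (k + j + 1).factorial) else 0 := by
  rw [← integral_indicator measurableSet_ball, ← Complex.integral_comp_polarCoord_symm,
    polarCoord_target, Measure.volume_eq_prod, ← Measure.prod_restrict]
  have h : ∀ p : ℝ × ℝ, p ∈ Set.Ioi (0 : ℝ) ×ˢ Set.Ioo (-Real.pi) Real.pi →
      p.1 • (Metric.ball (0 : ℂ) 1).indicator (fun ζ : ℂ =>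
        ζ ^ k * starRingEnd ℂ ζ ^ l * ((1 - ‖ζ‖ ^ 2 : ℝ) : ℂ) ^ j) (Complex.polarCoord.symm p) =
      (Set.Ioo (0 : ℝ) 1).indicator (fun r : ℝ =>
        ((r ^ (k + l + 1) * (1 - r ^ 2) ^ j : ℝ) : ℂ)) p.1 *
        Complex.exp (((k - l : ℤ) : ℂ) * (p.2 * Complex.I)) := by
    rintro ⟨r, θ⟩ ⟨hr, -⟩
    simp only [Set.mem_Ioi] at hr
    have e : Complex.polarCoord.symm (r, θ) = r * Complex.exp (θ * Complex.I) := by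
      rw [Complex.polarCoord_symm_apply, Complex.exp_mul_I, Complex.ofReal_cos, Complex.ofReal_sin]
    have en : ‖(r : ℂ) * Complex.exp (θ * Complex.I)‖ = r := by
      rw [norm_mul, Complex.norm_exp_ofReal_mul_I, mul_one, Complex.norm_real,
        Real.norm_of_nonneg hr.le]
    rw [e]
    by_cases h1 : r < 1
    · have hi : r ∈ Set.Ioo (0 : ℝ) 1 := ⟨hr, h1⟩
      rw [Set.indicator_of_mem (by rw [mem_ball_zero_iff, en]; exact h1),
        Set.indicator_of_mem hi, en]
      have e2 : Complex.exp (((k - l : ℤ) : ℂ) * (θ * Complex.I)) =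
          Complex.exp (θ * Complex.I) ^ k * starRingEnd ℂ (Complex.exp (θ * Complex.I)) ^ l := by
        rw [← Complex.exp_conj, ← Complex.exp_nat_mul, ← Complex.exp_nat_mul, ← Complex.exp_add]
        congr 1
        simp
        ring
      simp only [e2, map_mul, Complex.conj_ofReal, Complex.real_smul]
      push_cast
      ring
    · rw [Set.indicator_of_notMem (by rw [mem_ball_zero_iff, en]; exact h1),
        Set.indicator_of_notMem (by simp [h1])]
      simp
  rw [Measure.prod_restrict, setIntegral_congr_fun (measurableSet_Ioi.prod measurableSet_Ioo) h,
    ← Measure.prod_restrict, integral_prod_mul (fun r : ℝ => (Set.Ioo (0 : ℝ) 1).indicator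
      (fun r : ℝ => ((r ^ (k + l + 1) * (1 - r ^ 2) ^ j : ℝ) : ℂ)) r)
      (fun θ : ℝ => Complex.exp (((k - l : ℤ) : ℂ) * (θ * Complex.I))), integral_exp_int_mul]
  rw [setIntegral_indicator measurableSet_Ioo, Set.inter_eq_self_of_subset_right
    Set.Ioo_subset_Ioi_self, ← integral_Ioc_eq_integral_Ioo,
    ← intervalIntegral.integral_of_le zero_le_one, intervalIntegral.integral_ofReal]
  by_cases hkl : k = l
  · subst hkl
    rw [← two_mul, integral_pow_mul_one_sub_sq_pow]
    simp
    ring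
  · rw [if_neg (by omega), if_neg hkl, mul_zero]

/-- The measure `dζ dθ` on the product of the unit disc and the circle. -/
noncomputable def discCircle : Measure (ℂ × ℝ) :=
  (volume.restrict (Metric.ball (0 : ℂ) 1)).prod
    (volume.restrict (Set.Ioo (-Real.pi) Real.pi))

instance : IsFiniteMeasure discCircle := by
  have : IsFiniteMeasure (volume.restrict (Metric.ball (0 : ℂ) 1)) :=
    isFiniteMeasure_restrict.2 measure_ball_lt_top.ne
  have : IsFiniteMeasure (volume.restrict (Set.Ioo (-Real.pi) Real.pi)) :=
    isFiniteMeasure_restrict.2 (by simp)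
  rw [discCircle]
  infer_instance

theorem ae_discCircle : ∀ᵐ p ∂discCircle, ‖p.1‖ < 1 := by
  rw [discCircle, Measure.prod_restrict]
  filter_upwards [ae_restrict_mem (measurableSet_ball.prod measurableSet_Ioo)] with p hp
  exact mem_ball_zero_iff.1 hp.1

/-- A linear form on the sphere in the coordinates of `discCircle`. -/
noncomputable def linearForm (α : ℂ) (β : ℂ → ℂ) (p : ℂ × ℝ) : ℂ :=
  α * p.1 + β p.1 * Complex.exp (p.2 * Complex.I)

section

variable {α : ℂ} {β : ℂ → ℂ} {B : ℝ}

theorem measurable_linearForm (hβm : Measurable β) : Measurable (linearForm α β) := by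
  unfold linearForm
  fun_prop

/-- Cauchy–Schwarz for (‖α‖, √B) against the unit vector (|ζ|, √(1 - |ζ|²)). -/
theorem norm_linearForm_le (hB : 0 ≤ B)
    (hβ : ∀ ζ : ℂ, ‖ζ‖ < 1 → ‖β ζ‖ ^ 2 = B * (1 - ‖ζ‖ ^ 2)) {p : ℂ × ℝ} (hp : ‖p.1‖ < 1) :
    ‖linearForm α β p‖ ≤ Real.sqrt (‖α‖ ^ 2 + B) := by
  have h1 : ‖linearForm α β p‖ ≤ ‖α‖ * ‖p.1‖ + ‖β p.1‖ := by
    refine (norm_add_le _ _).trans ?_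
    rw [norm_mul, norm_mul, Complex.norm_exp_ofReal_mul_I, mul_one]
  refine h1.trans (Real.le_sqrt_of_sq_le ?_)
  have h2 := hβ p.1 hp
  obtain ⟨b, hb0, hb⟩ : ∃ b, 0 ≤ b ∧ b ^ 2 = B := ⟨Real.sqrt B, Real.sqrt_nonneg _, Real.sq_sqrt hB⟩
  obtain ⟨t, ht0, ht⟩ : ∃ t, 0 ≤ t ∧ t ^ 2 = 1 - ‖p.1‖ ^ 2 :=
    ⟨Real.sqrt _, Real.sqrt_nonneg _, Real.sq_sqrt (by nlinarith [norm_nonneg p.1])⟩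
  have h3 : ‖β p.1‖ = b * t := by
    rw [← sq_eq_sq₀ (norm_nonneg _) (by positivity), h2, mul_pow, hb, ht]
  rw [h3, ← hb]
  nlinarith [sq_nonneg (‖α‖ * t - b * ‖p.1‖)]

/-- After binomial expansion the θ-integral forces m - k = n - l, so β enters only through |β|² and
its phase is irrelevant; the disc integral forces k = l. The remaining terms add up by the binomial
theorem. -/
theorem integral_linearForm_pow (hB : 0 ≤ B) (hβm : Measurable β)
    (hβ : ∀ ζ : ℂ, ‖ζ‖ < 1 → ‖β ζ‖ ^ 2 = B * (1 - ‖ζ‖ ^ 2)) (m n : ℕ) :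
    ∫ p, linearForm α β p ^ m * starRingEnd ℂ (linearForm α β p) ^ n ∂discCircle =
      if m = n then 2 * (Real.pi : ℂ) ^ 2 * (((‖α‖ ^ 2 + B) ^ n / (n + 1) : ℝ) : ℂ) else 0 := by
  set f : ℕ → ℕ → ℂ → ℂ := fun k l ζ => (m.choose k * n.choose l : ℂ) *
    ((α * ζ) ^ k * starRingEnd ℂ (α * ζ) ^ l * (β ζ ^ (m - k) * starRingEnd ℂ (β ζ) ^ (n - l)))
    with hf
  set e : ℕ → ℕ → ℝ → ℂ := fun k l θ =>
    Complex.exp ((((m - k : ℕ) : ℤ) - ((n - l : ℕ) : ℤ) : ℤ) * (θ * Complex.I)) with he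
  have hexpand : ∀ p : ℂ × ℝ, linearForm α β p ^ m * starRingEnd ℂ (linearForm α β p) ^ n =
      ∑ k ∈ Finset.range (m + 1), ∑ l ∈ Finset.range (n + 1), f k l p.1 * e k l p.2 := by
    intro p
    have hexp : ∀ k l, e k l p.2 = Complex.exp (p.2 * Complex.I) ^ (m - k) *
        starRingEnd ℂ (Complex.exp (p.2 * Complex.I)) ^ (n - l) := by
      intro k l
      simp only [he]
      rw [← Complex.exp_conj, ← Complex.exp_nat_mul, ← Complex.exp_nat_mul, ← Complex.exp_add]
      congr 1
      simp only [map_mul, Complex.conj_ofReal, Complex.conj_I, Int.cast_sub, Int.cast_natCast]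
      ring
    rw [linearForm, map_add, add_pow, add_pow, Finset.sum_mul_sum]
    refine Finset.sum_congr rfl fun k _ => Finset.sum_congr rfl fun l _ => ?_
    rw [hexp, hf]
    simp only [map_mul, mul_pow]
    ring
  have hint : ∀ k l, Integrable (fun p : ℂ × ℝ => f k l p.1 * e k l p.2) discCircle := by
    intro k l
    refine Integrable.of_bound (C := (m.choose k * n.choose l) * (‖α‖ ^ k * ‖α‖ ^ l *
      (Real.sqrt B ^ (m - k) * Real.sqrt B ^ (n - l)))) ?_ ?_
    · refine Measurable.aestronglyMeasurable ?_
      simp only [hf, he]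
      fun_prop
    · filter_upwards [ae_discCircle] with p hp
      have hb : ‖β p.1‖ ≤ Real.sqrt B := by
        refine Real.le_sqrt_of_sq_le ?_
        rw [hβ p.1 hp]
        nlinarith [sq_nonneg ‖p.1‖]
      have ha : ‖α * p.1‖ ≤ ‖α‖ := by
        rw [norm_mul]; exact mul_le_of_le_one_right (norm_nonneg _) hp.le
      have hen : ‖e k l p.2‖ = 1 := by
        rw [he]
        beta_reduce
        rw [← mul_assoc, ← Complex.ofReal_intCast, ← Complex.ofReal_mul,
          Complex.norm_exp_ofReal_mul_I]
      rw [norm_mul, hen, mul_one, hf]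
      simp only [norm_mul, norm_pow, RCLike.norm_conj, Complex.norm_natCast] at ha ⊢
      gcongr
  have hterm : ∀ k ∈ Finset.range (m + 1), ∀ l ∈ Finset.range (n + 1),
      ∫ p, f k l p.1 * e k l p.2 ∂discCircle = if m = n ∧ k = l then
        2 * (Real.pi : ℂ) ^ 2 * (((‖α‖ ^ 2) ^ k * B ^ (n - k) * n.choose k / (n + 1) : ℝ) : ℂ)
          else 0 := by
    intro k hk l hl
    rw [Finset.mem_range] at hk hl
    rw [discCircle, integral_prod_mul, he, integral_exp_int_mul]
    by_cases hkl : m - k = n - l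
    · have hfd : ∀ ζ ∈ Metric.ball (0 : ℂ) 1, f k l ζ = (m.choose k * n.choose l : ℂ) *
          (α ^ k * starRingEnd ℂ α ^ l * (B : ℂ) ^ (n - l)) *
          (ζ ^ k * starRingEnd ℂ ζ ^ l * ((1 - ‖ζ‖ ^ 2 : ℝ) : ℂ) ^ (n - l)) := by
        intro ζ hζ
        have h1 := hβ ζ (mem_ball_zero_iff.1 hζ)
        have h2 : β ζ ^ (n - l) * starRingEnd ℂ (β ζ) ^ (n - l) =
            (B : ℂ) ^ (n - l) * ((1 - ‖ζ‖ ^ 2 : ℝ) : ℂ) ^ (n - l) := by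
          rw [← mul_pow, ← mul_pow, Complex.mul_conj, Complex.normSq_eq_norm_sq, h1]
          push_cast
          rfl
        rw [hf]
        beta_reduce
        rw [hkl, h2]
        simp only [map_mul, mul_pow]
        ring
      rw [setIntegral_congr_fun measurableSet_ball hfd, integral_const_mul, integral_disc,
        if_pos (show ((m - k : ℕ) : ℤ) - ((n - l : ℕ) : ℤ) = 0 by omega)]
      by_cases h : k = l
      · subst h
        have hmn : m = n := by omega
        subst hmn
        rw [if_pos rfl, if_pos ⟨rfl, rfl⟩]
        have h3 : α ^ k * starRingEnd ℂ α ^ k = (((‖α‖ ^ 2) ^ k : ℝ) : ℂ) := by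
          rw [← mul_pow, Complex.mul_conj, Complex.normSq_eq_norm_sq]
          push_cast
          rfl
        have h4 : ((m.choose k : ℂ) * k.factorial * (m - k).factorial) = m.factorial := by
          exact_mod_cast Nat.choose_mul_factorial_mul_factorial (by omega : k ≤ m)
        have h5 : (m.factorial : ℂ) ≠ 0 := Nat.cast_ne_zero.2 m.factorial_ne_zero
        have h6 : (m : ℂ) + 1 ≠ 0 := Nat.cast_add_one_ne_zero m
        rw [h3, show k + (m - k) + 1 = m + 1 by omega, Nat.factorial_succ]
        push_cast
        -- One binomial coefficient cancels the Beta factorials, so the weight 1/(m + 1) is the same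
        -- for every k.
        have h7 : (k.factorial * (m - k).factorial : ℂ) / ((m + 1) * m.factorial) * m.choose k =
            1 / (m + 1) := by
          rw [div_mul_eq_mul_div, div_eq_div_iff (mul_ne_zero h6 h5) h6]
          linear_combination ((m : ℂ) + 1) * h4
        linear_combination (m.choose k : ℂ) * ((‖α‖ : ℂ) ^ 2) ^ k * (B : ℂ) ^ (m - k) *
          (2 * Real.pi ^ 2) * h7
      · rw [if_neg h, if_neg (by tauto)]
        simp
    · rw [if_neg (show ((m - k : ℕ) : ℤ) - ((n - l : ℕ) : ℤ) ≠ 0 by omega), mul_zero, if_neg]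
      rintro ⟨rfl, rfl⟩
      exact hkl rfl
  simp_rw [hexpand]
  rw [integral_finsetSum _ fun k _ => integrable_finsetSum _ fun l _ => hint k l]
  simp_rw [integral_finsetSum _ fun l _ => hint _ l]
  rw [Finset.sum_congr rfl fun k hk => Finset.sum_congr rfl fun l hl => hterm k hk l hl]
  by_cases hmn : m = n
  · subst hmn
    rw [if_pos rfl, add_pow]
    simp only [true_and, Finset.sum_ite_eq, Finset.mem_range]
    rw [Finset.sum_div, Complex.ofReal_sum, Finset.mul_sum]
    refine Finset.sum_congr rfl fun k hk => ?_
    rw [if_pos (Finset.mem_range.1 hk)]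
  · simp [hmn]

end

/-! ### Integrating the binomial series -/

/-- Termwise integration of a power series against a bounded function. -/
theorem hasSum_integral_mul_pow {X : Type*} [MeasurableSpace X] {μ : Measure X} [IsFiniteMeasure μ]
    {f y S : X → ℂ} {c : ℕ → ℂ} {C r : ℝ} (hf : Measurable f) (hy : Measurable y) (hC : 0 ≤ C)
    (hfC : ∀ᵐ p ∂μ, ‖f p‖ ≤ C) (hyr : ∀ᵐ p ∂μ, ‖y p‖ ≤ r)
    (hc : Summable fun n => ‖c n‖ * r ^ n) (hS : ∀ᵐ p ∂μ, HasSum (fun n => c n * y p ^ n) (S p)) :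
    HasSum (fun n => c n * ∫ p, f p * y p ^ n ∂μ) (∫ p, f p * S p ∂μ) := by
  have h : HasSum (fun n => ∫ p, f p * (c n * y p ^ n) ∂μ) (∫ p, f p * S p ∂μ) := by
    refine hasSum_integral_of_dominated_convergence (fun n _ => C * (‖c n‖ * r ^ n))
      (fun n => (hf.mul ((hy.pow_const n).const_mul (c n))).aestronglyMeasurable) (fun n => ?_)
      (ae_of_all _ fun _ => hc.mul_left C) (integrable_const _) ?_
    · filter_upwards [hfC, hyr] with p h1 h2
      rw [norm_mul, norm_mul, norm_pow]
      gcongr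
    · filter_upwards [hS] with p hp using hp.mul_left (f p)
  refine h.congr_fun fun n => ?_
  rw [← integral_const_mul]
  exact integral_congr_ae (ae_of_all _ fun p => by ring)

theorem summable_norm_coeff (s : ℂ) {r : ℝ} (hr0 : 0 ≤ r) (hr : r < 1) :
    Summable fun n => ‖Hypergeometric.coeff s 1 1 n‖ * r ^ n := by
  have h := (Hypergeometric.hasSum_binomial s (z := (r : ℂ)) (by
    rwa [Complex.norm_real, Real.norm_of_nonneg hr0])).summable.norm
  refine h.congr fun n => ?_
  rw [norm_mul, norm_pow, Complex.norm_real, Real.norm_of_nonneg hr0]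

theorem norm_one_sub_cpow_le (s : ℂ) {z : ℂ} {r : ℝ} (hz : ‖z‖ ≤ r) (hr : r < 1) :
    ‖(1 - z) ^ (-s)‖ ≤ ∑' n, ‖Hypergeometric.coeff s 1 1 n‖ * r ^ n := by
  rw [← (Hypergeometric.hasSum_binomial s (hz.trans_lt hr)).tsum_eq]
  refine tsum_of_norm_bounded (summable_norm_coeff s ((norm_nonneg z).trans hz) hr).hasSum
    fun n => ?_
  rw [norm_mul, norm_pow]
  gcongr

/-- Since (2)_n = (n + 1)!, the moment factor 1/(n + 1) turns the squared binomial coefficient into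
a coefficient of F(s, s; 2; ·). -/
theorem coeff_one_one_sq (s : ℂ) (n : ℕ) :
    Hypergeometric.coeff s 1 1 n ^ 2 / (n + 1) = Hypergeometric.coeff s s 2 n := by
  induction n with
  | zero => simp [Hypergeometric.coefficient_zero]
  | succ n ih =>
    have h3 : (n : ℂ) + 1 ≠ 0 := Nat.cast_add_one_ne_zero n
    have h3' : (1 : ℂ) + n ≠ 0 := by rwa [add_comm]
    have h4 : (n : ℂ) + 2 ≠ 0 := by exact_mod_cast (by omega : n + 2 ≠ 0)
    have h4' : (2 : ℂ) + n ≠ 0 := by rwa [add_comm]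
    have h4'' : (n : ℂ) + 1 + 1 ≠ 0 := by rwa [add_assoc, one_add_one_eq_two]
    rw [Hypergeometric.coefficient_succ Hypergeometric.one_ne_neg_natCast,
      Hypergeometric.coefficient_succ Hypergeometric.two_ne_neg_natCast, ← ih]
    push_cast
    field_simp
    ring

section

variable {α : ℂ} {β : ℂ → ℂ} {B : ℝ}

theorem integrable_binomial_linearForm (hB : 0 ≤ B) (hβm : Measurable β)
    (hβ : ∀ ζ : ℂ, ‖ζ‖ < 1 → ‖β ζ‖ ^ 2 = B * (1 - ‖ζ‖ ^ 2)) (hx : ‖α‖ ^ 2 + B < 1) (s : ℂ) :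
    Integrable (fun p => (1 - linearForm α β p) ^ (-s) *
      (1 - starRingEnd ℂ (linearForm α β p)) ^ (-s)) discCircle := by
  have hr1 : Real.sqrt (‖α‖ ^ 2 + B) < 1 := by rw [Real.sqrt_lt' one_pos]; simpa using hx
  have hym := measurable_linearForm (α := α) hβm
  refine Integrable.of_bound (Measurable.aestronglyMeasurable (by fun_prop))
    ((∑' n, ‖Hypergeometric.coeff s 1 1 n‖ * Real.sqrt (‖α‖ ^ 2 + B) ^ n) ^ 2) ?_
  filter_upwards [ae_discCircle] with p hp
  have h := norm_linearForm_le (α := α) hB hβ hp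
  rw [norm_mul, sq]
  refine mul_le_mul (norm_one_sub_cpow_le s h hr1)
    (norm_one_sub_cpow_le s (by rwa [RCLike.norm_conj]) hr1) (norm_nonneg _)
    (tsum_nonneg fun n => by positivity)

/-- The factors are expanded one at a time: against y^m, orthogonality leaves a single term of the
conjugate series, and the second expansion sums these terms. -/
theorem integral_binomial_linearForm (hB : 0 ≤ B) (hβm : Measurable β)
    (hβ : ∀ ζ : ℂ, ‖ζ‖ < 1 → ‖β ζ‖ ^ 2 = B * (1 - ‖ζ‖ ^ 2)) (hx : ‖α‖ ^ 2 + B < 1) (s : ℂ) :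
    ∫ p, (1 - linearForm α β p) ^ (-s) * (1 - starRingEnd ℂ (linearForm α β p)) ^ (-s)
        ∂discCircle =
      2 * (Real.pi : ℂ) ^ 2 * ordinaryHypergeometric s s 2 ((‖α‖ ^ 2 + B : ℝ) : ℂ) := by
  set a := Hypergeometric.coeff s 1 1
  set r := Real.sqrt (‖α‖ ^ 2 + B) with hr
  have hr0 : 0 ≤ r := Real.sqrt_nonneg _
  have hr1 : r < 1 := by rw [hr, Real.sqrt_lt' one_pos]; simpa using hx
  have hym := measurable_linearForm (α := α) hβm
  have hym' : Measurable fun p => starRingEnd ℂ (linearForm α β p) := by fun_prop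
  have hyr : ∀ᵐ p ∂discCircle, ‖linearForm α β p‖ ≤ r :=
    ae_discCircle.mono fun p hp => norm_linearForm_le hB hβ hp
  have hyr' : ∀ᵐ p ∂discCircle, ‖starRingEnd ℂ (linearForm α β p)‖ ≤ r :=
    hyr.mono fun p hp => by rwa [RCLike.norm_conj]
  have hsm := summable_norm_coeff s hr0 hr1
  have inner : ∀ m : ℕ, ∫ p, (1 - starRingEnd ℂ (linearForm α β p)) ^ (-s) *
      linearForm α β p ^ m ∂discCircle =
      a m * (2 * (Real.pi : ℂ) ^ 2 * (((‖α‖ ^ 2 + B) ^ m / (m + 1) : ℝ) : ℂ)) := by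
    intro m
    have h := hasSum_integral_mul_pow (f := fun p => linearForm α β p ^ m)
      (S := fun p => (1 - starRingEnd ℂ (linearForm α β p)) ^ (-s)) (hym.pow_const m) hym'
      zero_le_one (hyr.mono fun p hp => by
        rw [norm_pow]; exact pow_le_one₀ (norm_nonneg _) (hp.trans hr1.le)) hyr' hsm
      (hyr'.mono fun p hp => Hypergeometric.hasSum_binomial s (hp.trans_lt hr1))
    simp only [integral_linearForm_pow hB hβm hβ, mul_ite, mul_zero] at h
    simp only [mul_comm ((1 - starRingEnd ℂ _) ^ (-s))]
    rw [← h.tsum_eq, tsum_ite_eq']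
  have hbound : ∀ᵐ p ∂discCircle, ‖(1 - starRingEnd ℂ (linearForm α β p)) ^ (-s)‖ ≤
      ∑' n, ‖a n‖ * r ^ n := hyr'.mono fun p hp => norm_one_sub_cpow_le s hp hr1
  have outer := hasSum_integral_mul_pow
    (f := fun p => (1 - starRingEnd ℂ (linearForm α β p)) ^ (-s))
    (S := fun p => (1 - linearForm α β p) ^ (-s)) (by fun_prop) hym
    (tsum_nonneg fun n => by positivity) hbound hyr hsm
    (hyr.mono fun p hp => Hypergeometric.hasSum_binomial s (hp.trans_lt hr1))
  simp only [inner] at outer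
  simp only [mul_comm ((1 - linearForm α β _) ^ (-s))]
  refine outer.unique ?_
  have hxn : ‖((‖α‖ ^ 2 + B : ℝ) : ℂ)‖ < 1 := by
    rwa [Complex.norm_real, Real.norm_of_nonneg (by positivity)]
  refine ((Hypergeometric.hasSum s s 2 hxn).mul_left (2 * (Real.pi : ℂ) ^ 2)).congr_fun fun n => ?_
  rw [← coeff_one_one_sq]
  push_cast
  ring

end

/-! ### Geometry of the Siegel domain and transport of the integral to the sphere -/

theorem height_eq (Z : ℂ × ℂ) : height Z = 2 * Z.1.re - ‖Z.2‖ ^ 2 := by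
  rw [height, rho, ← Complex.normSq_eq_norm_sq, Complex.normSq_apply]
  simp
  ring

theorem height_pos {Z : ℂ × ℂ} (hZ : Z ∈ domain) : 0 < height Z := by
  rw [height_eq]
  have : ‖Z.2‖ ^ 2 < 2 * Z.1.re := hZ
  linarith

theorem two_mul_rho_re (Z Z' : ℂ × ℂ) :
    2 * (rho Z Z').re = height Z + height Z' + ‖Z'.2 - Z.2‖ ^ 2 := by
  rw [height_eq, height_eq, ← Complex.normSq_eq_norm_sq, ← Complex.normSq_eq_norm_sq,
    ← Complex.normSq_eq_norm_sq, Complex.normSq_apply, Complex.normSq_apply, Complex.normSq_apply,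
    rho]
  simp
  ring

theorem rho_ne_zero {Z Z' : ℂ × ℂ} (hZ : Z ∈ domain) (hZ' : Z' ∈ domain) : rho Z Z' ≠ 0 := by
  intro h
  have h1 := two_mul_rho_re Z Z'
  rw [h] at h1
  have := height_pos hZ
  have := height_pos hZ'
  have := sq_nonneg ‖Z'.2 - Z.2‖
  simp at h1
  linarith

/-- This identity serves twice: it gives u > 0 off the diagonal, and the squared norm 1 - 1/σ of the
linear form. -/
theorem norm_rho_sub_sq (Z Z' : ℂ × ℂ) :
    ‖rho Z Z' - height Z'‖ ^ 2 + ‖Z'.2 - Z.2‖ ^ 2 * height Z' =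
      ‖rho Z Z'‖ ^ 2 - height Z * height Z' := by
  have h := two_mul_rho_re Z Z'
  rw [← Complex.normSq_eq_norm_sq (rho Z Z' - height Z'), ← Complex.normSq_eq_norm_sq (rho Z Z'),
    Complex.normSq_apply, Complex.normSq_apply]
  simp only [Complex.sub_re, Complex.ofReal_re, Complex.sub_im, Complex.ofReal_im, sub_zero]
  linear_combination -height Z' * h

/-- Coordinates on the boundary for which `P(Z', W) ^ 2 dm(W)` is the measure `discCircle`. -/
noncomputable def boundaryParam (Z' : ℂ × ℂ) (p : ℂ × ℝ) : ℂ × ℝ :=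
  (Z'.2 + Real.sqrt (2 * (cayley (height Z' / 2) p.1).re) * Complex.exp (p.2 * Complex.I),
    Z'.1.im + (starRingEnd ℂ Z'.2 * (Z'.2 + Real.sqrt (2 * (cayley (height Z' / 2) p.1).re) *
      Complex.exp (p.2 * Complex.I))).im + (cayley (height Z' / 2) p.1).im)

/-- The density of the boundary measure in the coordinates `boundaryParam`. -/
noncomputable def boundaryDensity (Z' : ℂ × ℂ) (p : ℂ × ℝ) : ℝ := height Z' ^ 2 / ‖1 + p.1‖ ^ 4

theorem measurable_cayley (a : ℝ) : Measurable (cayley a) := by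
  unfold cayley
  fun_prop

theorem measurable_boundaryParam (Z' : ℂ × ℂ) : Measurable (boundaryParam Z') := by
  have := measurable_cayley (height Z' / 2)
  unfold boundaryParam
  fun_prop

theorem measurable_boundaryDensity (Z' : ℂ × ℂ) : Measurable (boundaryDensity Z') := by
  unfold boundaryDensity
  fun_prop

/-- A Heisenberg translation preserves the measure: for fixed w it translates v, and then w is
translated. -/
theorem lintegral_shear (b : ℂ) (t : ℝ) {g : ℂ × ℝ → ℝ≥0∞} (hg : Measurable g) :
    ∫⁻ p : ℂ × ℝ, g (b + p.1, t + (starRingEnd ℂ b * (b + p.1)).im + p.2) = ∫⁻ p, g p := by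
  have h : Measurable fun p : ℂ × ℝ => g (b + p.1, t + (starRingEnd ℂ b * (b + p.1)).im + p.2) :=
    hg.comp (by fun_prop)
  rw [Measure.volume_eq_prod, lintegral_prod _ hg.aemeasurable, lintegral_prod _ h.aemeasurable]
  have hin (w : ℂ) : ∫⁻ v : ℝ, g (b + w, t + (starRingEnd ℂ b * (b + w)).im + v) =
      ∫⁻ v, g (b + w, v) := lintegral_add_left_eq_self (fun v => g (b + w, v)) _
  simp only [hin]
  exact lintegral_add_left_eq_self (fun w => ∫⁻ v, g (w, v)) b

/-- The translation, polar coordinates and the Cayley transform with a = ρ(Z')/2 are composed; the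
density is the Cayley Jacobian (2a)²/|1 + ζ|⁴. -/
theorem map_boundaryParam {Z' : ℂ × ℂ} (hZ' : Z' ∈ domain) :
    (discCircle.withDensity fun p => ENNReal.ofReal (boundaryDensity Z' p)).map
      (boundaryParam Z') = volume := by
  have hpos := height_pos hZ'
  have hJ : Measurable fun p => ENNReal.ofReal (boundaryDensity Z' p) :=
    (measurable_boundaryDensity Z').ennreal_ofReal
  refine Measure.ext_of_lintegral _ fun g hg => ?_
  have hgp : Measurable fun p => g (boundaryParam Z' p) := hg.comp (measurable_boundaryParam Z')
  have hgs : Measurable fun p : ℂ × ℝ =>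
      g (Z'.2 + p.1, Z'.1.im + (starRingEnd ℂ Z'.2 * (Z'.2 + p.1)).im + p.2) :=
    hg.comp (by fun_prop)
  rw [lintegral_map hg (measurable_boundaryParam Z'),
    lintegral_withDensity_eq_lintegral_mul _ hJ hgp, discCircle,
    lintegral_prod _ (hJ.mul hgp).aemeasurable,
    ← lintegral_shear Z'.2 Z'.1.im hg, lintegral_eq_lintegral_halfPlane hgs,
    lintegral_halfPlane_eq_lintegral_disc (half_pos hpos)]
  refine lintegral_congr fun ζ => ?_
  rw [← lintegral_const_mul' _ _ ENNReal.ofReal_ne_top]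
  refine lintegral_congr fun θ => ?_
  simp only [Pi.mul_apply, boundaryDensity, boundaryParam]
  rw [mul_div_cancel₀ _ (two_ne_zero' ℝ)]

/-- The slope of the linear form `1 - (1 + ζ) ρ(Z, W) / ρ(Z, Z')` along the disc. -/
noncomputable def slope (Z Z' : ℂ × ℂ) : ℂ := (height Z' - rho Z Z') / rho Z Z'

/-- The slope of the linear form `1 - (1 + ζ) ρ(Z, W) / ρ(Z, Z')` along the circle. -/
noncomputable def slope' (Z Z' : ℂ × ℂ) (ζ : ℂ) : ℂ :=
  -(starRingEnd ℂ (Z'.2 - Z.2) * Real.sqrt (2 * (cayley (height Z' / 2) ζ).re) * (1 + ζ)) /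
    rho Z Z'

theorem measurable_slope' (Z Z' : ℂ × ℂ) : Measurable (slope' Z Z') := by
  have := measurable_cayley (height Z' / 2)
  unfold slope'
  fun_prop

theorem two_mul_cayley_re (a : ℝ) (ζ : ℂ) :
    2 * (cayley (a / 2) ζ).re = a * (1 - ‖ζ‖ ^ 2) / ‖1 + ζ‖ ^ 2 := by
  rw [cayley_re]; ring

theorem two_mul_cayley_re_nonneg {a : ℝ} (ha : 0 < a) {ζ : ℂ} (hζ : ‖ζ‖ < 1) :
    0 ≤ 2 * (cayley (a / 2) ζ).re := by
  have : 0 ≤ 1 - ‖ζ‖ ^ 2 := by nlinarith [norm_nonneg ζ]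
  rw [two_mul_cayley_re]
  positivity

section

variable {Z Z' : ℂ × ℂ}

/-- On the boundary |ω|² = 2 Re m, which absorbs the quadratic term and makes ρ(Z, ·) affine in (m,
ω). -/
theorem rho_boundaryPoint {m ω : ℂ} (h : ‖ω‖ ^ 2 = 2 * m.re) :
    rho Z (boundaryPoint (Z'.2 + ω, Z'.1.im + (starRingEnd ℂ Z'.2 * (Z'.2 + ω)).im + m.im)) =
      m - height Z' / 2 + rho Z Z' + starRingEnd ℂ (Z'.2 - Z.2) * ω := by
  rw [← Complex.normSq_eq_norm_sq, Complex.normSq_apply] at h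
  rw [height_eq]
  simp only [rho, boundaryPoint]
  rw [← Complex.normSq_eq_norm_sq, ← Complex.normSq_eq_norm_sq]
  apply Complex.ext
  · simp [Complex.normSq_apply]
    linear_combination h / 2
  · simp
    ring

/-- Multiplication by 1 + ζ clears the Cayley denominator, m (1 + ζ) = ρ(Z')/2 · (1 - ζ), and the
affine form becomes ρ(Z, Z') times 1 - y. -/
theorem rho_boundaryParam (hZ : Z ∈ domain) (hZ' : Z' ∈ domain) {p : ℂ × ℝ} (hp : ‖p.1‖ < 1) :
    rho Z (boundaryPoint (boundaryParam Z' p)) =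
      rho Z Z' * (1 - linearForm (slope Z Z') (slope' Z Z') p) / (1 + p.1) := by
  have h0 := one_add_ne_zero hp
  have hρ := rho_ne_zero hZ hZ'
  have hnn := two_mul_cayley_re_nonneg (height_pos hZ') hp
  rw [boundaryParam, rho_boundaryPoint, eq_div_iff h0, linearForm, slope, slope']
  · have hc : cayley (height Z' / 2) p.1 * (1 + p.1) = height Z' / 2 * (1 - p.1) := by
      rw [cayley, div_mul_cancel₀ _ h0]
      push_cast
      rfl
    field_simp
    linear_combination 2 * hc
  · rw [norm_mul, Complex.norm_exp_ofReal_mul_I, mul_one, Complex.norm_real,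
      Real.norm_of_nonneg (Real.sqrt_nonneg _), Real.sq_sqrt hnn]

/-- Both slopes vanish for Z = Z'. Hence P(Z', W) = |1 + ζ|²/ρ(Z'), whose square is the reciprocal
of the density. -/
theorem rho_boundaryParam_self (hZ' : Z' ∈ domain) {p : ℂ × ℝ} (hp : ‖p.1‖ < 1) :
    rho Z' (boundaryPoint (boundaryParam Z' p)) = height Z' / (1 + p.1) := by
  have hpos : (height Z' : ℂ) ≠ 0 := Complex.ofReal_ne_zero.2 (height_pos hZ').ne'
  rw [rho_boundaryParam hZ' hZ' hp, rho_self]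
  simp [linearForm, slope, slope', rho_self]

/-- The factor 1 + ζ cancels the denominator of Re m; only its phase remains in `slope'`, and the
moments do not see it. -/
theorem norm_slope'_sq (Z : ℂ × ℂ) (hZ' : Z' ∈ domain) {ζ : ℂ} (hζ : ‖ζ‖ < 1) :
    ‖slope' Z Z' ζ‖ ^ 2 =
      ‖Z'.2 - Z.2‖ ^ 2 * height Z' / ‖rho Z Z'‖ ^ 2 * (1 - ‖ζ‖ ^ 2) := by
  have h0 : ‖1 + ζ‖ ≠ 0 := norm_ne_zero_iff.2 (one_add_ne_zero hζ)
  have hnn := two_mul_cayley_re_nonneg (height_pos hZ') hζ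
  rw [slope', norm_div, norm_neg, norm_mul, norm_mul, RCLike.norm_conj, Complex.norm_real,
    Real.norm_of_nonneg (Real.sqrt_nonneg _), div_pow, mul_pow, mul_pow, Real.sq_sqrt hnn,
    two_mul_cayley_re]
  field_simp

theorem sigma_pos (hZ : Z ∈ domain) (hZ' : Z' ∈ domain) : 0 < sigma Z Z' := by
  have := height_pos hZ
  have := height_pos hZ'
  have := norm_pos_iff.2 (rho_ne_zero hZ hZ')
  rw [sigma]
  positivity

theorem norm_slope_sq_add (hZ : Z ∈ domain) (hZ' : Z' ∈ domain) :
    ‖slope Z Z'‖ ^ 2 + ‖Z'.2 - Z.2‖ ^ 2 * height Z' / ‖rho Z Z'‖ ^ 2 = 1 - (sigma Z Z')⁻¹ := by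
  have h0 := norm_ne_zero_iff.2 (rho_ne_zero hZ hZ')
  have h := norm_rho_sub_sq Z Z'
  rw [slope, norm_div, norm_sub_rev, sigma, inv_div, div_pow]
  field_simp
  linear_combination h

/-- Off the negative axis log z + log (conj z) = 2 log |z| on principal branches, so the power
splits. -/
theorem cpow_norm_sq {z : ℂ} (hz : z ∈ Complex.slitPlane) (t : ℂ) :
    ((‖z‖ ^ 2 : ℝ) : ℂ) ^ t = z ^ t * starRingEnd ℂ z ^ t := by
  have h0 := Complex.slitPlane_ne_zero hz
  have h1 : 0 < ‖z‖ := norm_pos_iff.2 h0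
  have h2 : ((‖z‖ ^ 2 : ℝ) : ℂ) ≠ 0 := Complex.ofReal_ne_zero.2 (by positivity)
  have h3 : starRingEnd ℂ z ≠ 0 := by simpa using h0
  rw [Complex.cpow_def_of_ne_zero h2, Complex.cpow_def_of_ne_zero h0,
    Complex.cpow_def_of_ne_zero h3, ← Complex.exp_add, Complex.log_conj _
      (Complex.slitPlane_arg_ne_pi hz), ← add_mul, Complex.add_conj, Complex.log_re,
    ← Complex.ofReal_log (by positivity), Real.log_pow]
  push_cast
  rfl

/-- With q = P(Z', W), the other kernel is q |1 - y|⁻²/σ and the density is q⁻². The exponents s and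
2 - s add up to 2, so q cancels. -/
theorem density_mul_phiIntegrand (hZ : Z ∈ domain) (hZ' : Z' ∈ domain) (s : ℂ) {p : ℂ × ℝ}
    (hp : ‖p.1‖ < 1) (hy : ‖linearForm (slope Z Z') (slope' Z Z') p‖ < 1) :
    (boundaryDensity Z' p : ℂ) * phiIntegrand Z Z' s (boundaryPoint (boundaryParam Z' p)) =
      (((sigma Z Z')⁻¹ : ℝ) : ℂ) ^ s * ((1 - linearForm (slope Z Z') (slope' Z Z') p) ^ (-s) *
        (1 - starRingEnd ℂ (linearForm (slope Z Z') (slope' Z Z') p)) ^ (-s)) := by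
  set y := linearForm (slope Z Z') (slope' Z Z') p
  have hh := height_pos hZ
  have hh' := height_pos hZ'
  have hσ := sigma_pos hZ hZ'
  have hs := Hypergeometric.one_sub_mem_slitPlane hy
  have hN : 0 < ‖1 - y‖ := norm_pos_iff.2 (Complex.slitPlane_ne_zero hs)
  have hk : 0 < ‖1 + p.1‖ := norm_pos_iff.2 (one_add_ne_zero hp)
  have hρ : 0 < ‖rho Z Z'‖ := norm_pos_iff.2 (rho_ne_zero hZ hZ')
  set q : ℝ := ‖1 + p.1‖ ^ 2 / height Z' with hq
  have hq0 : 0 < q := by positivity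
  have e1 : poisson Z' (boundaryPoint (boundaryParam Z' p)) = q := by
    rw [poisson, rho_boundaryParam_self hZ' hp, norm_div, Complex.norm_real,
      Real.norm_of_nonneg hh'.le, hq]
    field_simp
  have e2 : poisson Z (boundaryPoint (boundaryParam Z' p)) =
      (sigma Z Z')⁻¹ * (‖1 - y‖ ^ 2)⁻¹ * q := by
    have h : rho Z (boundaryPoint (boundaryParam Z' p)) = rho Z Z' * (1 - y) / (1 + p.1) :=
      rho_boundaryParam hZ hZ' hp
    rw [poisson, h, norm_div, norm_mul, hq, sigma]
    field_simp
  have e3 : boundaryDensity Z' p = (q ^ 2)⁻¹ := by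
    rw [boundaryDensity, hq]
    field_simp
  have e4 : (((‖1 - y‖ ^ 2)⁻¹ : ℝ) : ℂ) ^ s = (1 - y) ^ (-s) * (1 - starRingEnd ℂ y) ^ (-s) := by
    have := cpow_norm_sq hs (-s)
    rw [map_sub, map_one] at this
    rw [← this, Complex.cpow_neg, Complex.ofReal_inv, Complex.inv_cpow]
    rw [Complex.arg_ofReal_of_nonneg (by positivity)]
    exact Real.pi_pos.ne
  have hqc : (q : ℂ) ≠ 0 := Complex.ofReal_ne_zero.2 hq0.ne'
  have e5 : (q : ℂ) ^ s * (q : ℂ) ^ (2 - s) = q ^ 2 := by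
    rw [← Complex.cpow_add _ _ hqc, add_sub_cancel]
    exact_mod_cast Complex.cpow_natCast (q : ℂ) 2
  rw [phiIntegrand, e1, e2, e3, Complex.ofReal_mul, Complex.ofReal_mul (sigma Z Z')⁻¹,
    ← Complex.ofReal_mul, Complex.mul_cpow_ofReal_nonneg (by positivity) hq0.le,
    Complex.ofReal_mul, Complex.mul_cpow_ofReal_nonneg (by positivity) (by positivity), e4]
  rw [mul_assoc (_ * _), e5]
  push_cast
  field_simp

theorem measurable_rho (Z : ℂ × ℂ) : Measurable (rho Z) := by
  unfold rho
  fun_prop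

theorem measurable_phiIntegrand (Z Z' : ℂ × ℂ) (s : ℂ) : Measurable (phiIntegrand Z Z' s) := by
  have h (Z : ℂ × ℂ) : Measurable fun W : boundary => poisson Z W := by
    have := (measurable_rho Z).comp (measurable_subtype_coe (p := fun W => W ∈ boundary))
    exact (this.norm.pow_const 2).const_div _
  unfold phiIntegrand
  have := h Z
  have := h Z'
  fun_prop

theorem measurable_boundaryPoint : Measurable boundaryPoint := by
  refine Measurable.subtype_mk ?_
  fun_prop

theorem boundaryMeasure_eq (hZ' : Z' ∈ domain) : boundaryMeasure =
    (discCircle.withDensity fun p => ENNReal.ofReal (boundaryDensity Z' p)).map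
      fun p => boundaryPoint (boundaryParam Z' p) := by
  rw [boundaryMeasure, ← map_boundaryParam hZ',
    Measure.map_map measurable_boundaryPoint (measurable_boundaryParam Z')]
  rfl

theorem toReal_smul_phiIntegrand (hZ : Z ∈ domain) (hZ' : Z' ∈ domain) (s : ℂ) :
    (fun p => (ENNReal.ofReal (boundaryDensity Z' p)).toReal •
      phiIntegrand Z Z' s (boundaryPoint (boundaryParam Z' p))) =ᵐ[discCircle] fun p =>
      (((sigma Z Z')⁻¹ : ℝ) : ℂ) ^ s * ((1 - linearForm (slope Z Z') (slope' Z Z') p) ^ (-s) *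
        (1 - starRingEnd ℂ (linearForm (slope Z Z') (slope' Z Z') p)) ^ (-s)) := by
  have hσ := sigma_pos hZ hZ'
  have hh' := height_pos hZ'
  filter_upwards [ae_discCircle] with p hp
  rw [ENNReal.toReal_ofReal (by rw [boundaryDensity]; positivity), Complex.real_smul,
    density_mul_phiIntegrand hZ hZ' s hp]
  refine (norm_linearForm_le (by positivity) (fun ζ hζ => norm_slope'_sq Z hZ' hζ) hp).trans_lt ?_
  rw [norm_slope_sq_add hZ hZ', Real.sqrt_lt' one_pos]
  simpa using hσ

end

section

variable {Z Z' : ℂ × ℂ}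

theorem norm_slope_sq_add_lt_one (hZ : Z ∈ domain) (hZ' : Z' ∈ domain) :
    ‖slope Z Z'‖ ^ 2 + ‖Z'.2 - Z.2‖ ^ 2 * height Z' / ‖rho Z Z'‖ ^ 2 < 1 := by
  rw [norm_slope_sq_add hZ hZ']
  simpa using sigma_pos hZ hZ'

/-- After transport the integrand is bounded on a finite measure space, because |y| ≤ √(1 - 1/σ) <
1; this is insensitive to s. -/
theorem integrable_phiIntegrand (hZ : Z ∈ domain) (hZ' : Z' ∈ domain) (s : ℂ) :
    Integrable (phiIntegrand Z Z' s) boundaryMeasure := by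
  have hh' := height_pos hZ'
  have hm : Measurable fun p => boundaryPoint (boundaryParam Z' p) :=
    measurable_boundaryPoint.comp (measurable_boundaryParam Z')
  rw [boundaryMeasure_eq hZ', integrable_map_measure
      (measurable_phiIntegrand Z Z' s).aestronglyMeasurable hm.aemeasurable,
    integrable_withDensity_iff_integrable_smul' (measurable_boundaryDensity Z').ennreal_ofReal
      (ae_of_all _ fun _ => ENNReal.ofReal_lt_top)]
  refine Integrable.congr ?_ (toReal_smul_phiIntegrand hZ hZ' s).symm
  exact (integrable_binomial_linearForm (by positivity) (measurable_slope' Z Z')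
    (fun ζ hζ => norm_slope'_sq Z hZ' hζ) (norm_slope_sq_add_lt_one hZ hZ') s).const_mul _

theorem phi_eq_hypergeometric (hZ : Z ∈ domain) (hZ' : Z' ∈ domain) (s : ℂ) :
    phi Z Z' s = 2 * (Real.pi : ℂ) ^ 2 * ((((sigma Z Z')⁻¹ : ℝ) : ℂ) ^ s *
      ordinaryHypergeometric s s 2 (1 - (((sigma Z Z')⁻¹ : ℝ) : ℂ))) := by
  have hh' := height_pos hZ'
  have hm : Measurable fun p => boundaryPoint (boundaryParam Z' p) :=
    measurable_boundaryPoint.comp (measurable_boundaryParam Z')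
  rw [phi, boundaryMeasure_eq hZ', integral_map hm.aemeasurable
      (measurable_phiIntegrand Z Z' s).aestronglyMeasurable,
    integral_withDensity_eq_integral_toReal_smul (measurable_boundaryDensity Z').ennreal_ofReal
      (ae_of_all _ fun _ => ENNReal.ofReal_lt_top)]
  rw [integral_congr_ae (toReal_smul_phiIntegrand hZ hZ' s), integral_const_mul,
    integral_binomial_linearForm (by positivity) (measurable_slope' Z Z')
      (fun ζ hζ => norm_slope'_sq Z hZ' hζ) (norm_slope_sq_add_lt_one hZ hZ') s,
    norm_slope_sq_add hZ hZ', Complex.ofReal_sub, Complex.ofReal_one]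
  ring

/-- By `norm_rho_sub_sq` the numerator |ρ(Z, Z')|² - ρ(Z)ρ(Z') is a sum of two nonnegative terms
that both vanish only for Z = Z'. -/
theorem u_pos (hZ : Z ∈ domain) (hZ' : Z' ∈ domain) (hne : Z ≠ Z') : 0 < u Z Z' := by
  have hh := height_pos hZ
  have hh' := height_pos hZ'
  rw [u, sub_pos, sigma, one_lt_div (by positivity), ← sub_pos, ← norm_rho_sub_sq]
  by_cases h2 : Z'.2 = Z.2
  · have h1 : rho Z Z' - height Z' ≠ 0 := by
      intro h
      rw [← rho_self, rho, rho, h2] at h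
      refine hne (Prod.ext ((starRingEnd ℂ).injective ?_) h2.symm)
      linear_combination h
    have := norm_pos_iff.2 h1
    positivity
  · have := norm_pos_iff.2 (sub_ne_zero.2 h2)
    positivity

end

/-! ### Matching the closed form with the stated terms -/

theorem sigma_eq (Z Z' : ℂ × ℂ) : sigma Z Z' = 1 + u Z Z' := by
  rw [u, add_sub_cancel]

/-- Legendre's duplication formula at 1 - s, together with Γ(2 - s) = (1 - s) Γ(1 - s). -/
theorem gamma_duplication {s : ℂ} (hs : s ∈ Hypergeometric.regularSet) :
    -((Real.pi : ℂ) / (s - 1)) *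
      ((Real.sqrt Real.pi : ℂ) * Complex.Gamma (3 / 2 - s) / Complex.Gamma (2 - s)) *
      (1 / 4 : ℂ) ^ (s - 1) = 2 * (Real.pi : ℂ) ^ 2 * Hypergeometric.connectionCoeff s := by
  have h1 : 1 - s ≠ 0 := by
    intro h
    refine hs 2 ?_
    push_cast
    linear_combination -2 * h
  have hG : Complex.Gamma (2 - s) = (1 - s) * Complex.Gamma (1 - s) := by
    rw [← Complex.Gamma_add_one _ h1]
    ring_nf
  have hG1 : Complex.Gamma (1 - s) ≠ 0 := by
    refine Complex.Gamma_ne_zero fun m h => hs (2 * (m + 1)) ?_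
    push_cast
    linear_combination -2 * h
  have hd := Complex.Gamma_mul_Gamma_add_half (1 - s)
  rw [show 1 - s + 1 / 2 = 3 / 2 - s by ring, show 2 * (1 - s) = 2 - 2 * s by ring,
    show 1 - (2 - 2 * s) = 2 * (s - 1) + 1 by ring, Complex.cpow_add _ _ two_ne_zero,
    Complex.cpow_one] at hd
  have h4 : (1 / 4 : ℂ) ^ (s - 1) * 2 ^ (2 * (s - 1)) = 1 := by
    have e1 := Complex.mul_cpow_ofReal_nonneg (a := 1 / 4) (b := 2) (by norm_num) (by norm_num)
      (s - 1)
    have e2 := Complex.mul_cpow_ofReal_nonneg (a := 1 / 4 * 2) (b := 2) (by norm_num)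
      (by norm_num) (s - 1)
    push_cast at e1 e2
    rw [two_mul, Complex.cpow_add _ _ two_ne_zero, ← mul_assoc, ← e1, ← e2]
    norm_num
  have hpi : (Real.sqrt Real.pi : ℂ) * Real.sqrt Real.pi = Real.pi := by
    rw [← Complex.ofReal_mul, Real.mul_self_sqrt Real.pi_pos.le]
  have hs1 : s - 1 ≠ 0 := by
    rw [← neg_sub]; exact neg_ne_zero.2 h1
  rw [Hypergeometric.connectionCoeff, hG]
  have h5 : Complex.Gamma (1 - s) * Complex.Gamma (3 / 2 - s) * (1 / 4 : ℂ) ^ (s - 1) =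
      2 * Complex.Gamma (2 - 2 * s) * Real.sqrt Real.pi := by
    linear_combination (1 / 4 : ℂ) ^ (s - 1) * hd +
      2 * Complex.Gamma (2 - 2 * s) * Real.sqrt Real.pi * h4
  generalize Complex.Gamma (1 - s) = G at hG1 h5 ⊢
  generalize Complex.Gamma (3 / 2 - s) = H at h5 ⊢
  generalize Complex.Gamma (2 - 2 * s) = K at h5 ⊢
  generalize (1 / 4 : ℂ) ^ (s - 1) = q at h5 ⊢
  rw [show s - 1 = -(1 - s) by ring]
  field_simp
  linear_combination (Real.sqrt Real.pi : ℂ) * h5 + 2 * K * hpi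

/-- Pfaff's transformation at z = -1/u has z/(z - 1) = 1/(1 + u) and second parameter (2s - 1) - (s
- 1) = s; the powers combine by u (1 + 1/u) = 1 + u. -/
theorem term_eq {u : ℝ} (hu : 0 < u) {s : ℂ} (hs : s ∈ Hypergeometric.regularSet) :
    term u s = 2 * (Real.pi : ℂ) ^ 2 * (Hypergeometric.connectionCoeff s *
      ((((1 + u)⁻¹ : ℝ) : ℂ) ^ s *
        ordinaryHypergeometric s s (2 * s - 1) (((1 + u)⁻¹ : ℝ) : ℂ))) := by
  have hu' : (u : ℂ) ≠ 0 := Complex.ofReal_ne_zero.2 hu.ne'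
  rw [term, gamma_duplication hs, ← Complex.ofReal_inv, Hypergeometric.hypF_neg_ofReal
    (Hypergeometric.two_mul_sub_one_ne hs) (inv_nonneg.2 hu.le),
    show u⁻¹ / (1 + u⁻¹) = (1 + u)⁻¹ by field_simp; ring, show 2 * s - 1 - (s - 1) = s by ring]
  have h : (u : ℂ) ^ (-s) * ((1 + u⁻¹ : ℝ) : ℂ) ^ (-s) = (((1 + u)⁻¹ : ℝ) : ℂ) ^ s := by
    rw [← Complex.mul_cpow_ofReal_nonneg hu.le (by positivity), ← Complex.ofReal_mul,
      show u * (1 + u⁻¹) = 1 + u by field_simp; ring, Complex.cpow_neg, Complex.ofReal_inv,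
      Complex.inv_cpow]
    rw [Complex.arg_ofReal_of_nonneg (by positivity)]
    exact Real.pi_pos.ne
  rw [← h]
  ring

theorem term_add_term {u : ℝ} (hu : 0 < u) {s : ℂ} (hs : s ∈ Hypergeometric.regularSet) :
    term u s + term u (2 - s) = 2 * (Real.pi : ℂ) ^ 2 * ((((1 + u)⁻¹ : ℝ) : ℂ) ^ s *
      ordinaryHypergeometric s s 2 (1 - (((1 + u)⁻¹ : ℝ) : ℂ))) := by
  have h1 : (1 + u)⁻¹ < 1 := inv_lt_one_of_one_lt₀ (by linarith)
  have h0 : 0 < (1 + u)⁻¹ := by positivity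
  have hξ : (((1 + u)⁻¹ : ℝ) : ℂ) ∈ Hypergeometric.lens := by
    rw [Hypergeometric.mem_lens, ← Complex.ofReal_one, ← Complex.ofReal_sub, Complex.norm_real,
      Complex.norm_real, Real.norm_of_nonneg h0.le, Real.norm_of_nonneg (by linarith)]
    exact ⟨h1, by linarith⟩
  rw [Hypergeometric.connection hs hξ, term_eq hu hs, term_eq hu
    (Hypergeometric.two_mul_two_sub_ne hs), show 2 * (2 - s) - 1 = 3 - 2 * s by ring]
  ring

/-- The Gamma prefactor of the Green function is 1/c(s); the factor c(2 - s) is the Gamma quotient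
in T(s). -/
theorem term_eq_green (Z Z' : ℂ × ℂ) {s : ℂ} (hs : s ∈ Hypergeometric.regularSet) :
    term (u Z Z') s = -((Real.pi : ℂ) / (s - 1)) * cFun s * cFun (2 - s) * green Z Z' s := by
  have h1 : Complex.Gamma s ≠ 0 := by
    refine Complex.Gamma_ne_zero fun m h => hs (-2 * m) ?_
    push_cast
    linear_combination 2 * h
  have h2 : Complex.Gamma (s - 1 / 2) ≠ 0 := by
    refine Complex.Gamma_ne_zero fun m h => hs (-2 * m + 1) ?_
    push_cast
    linear_combination 2 * h
  have h3 : (Real.sqrt Real.pi : ℂ) ≠ 0 :=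
    Complex.ofReal_ne_zero.2 (Real.sqrt_pos.2 Real.pi_pos).ne'
  rw [term, cFun, cFun, green, show 2 - s - 1 / 2 = 3 / 2 - s by ring]
  generalize Complex.Gamma (s - 1 / 2) = G at h2 ⊢
  generalize Complex.Gamma (3 / 2 - s) = H
  field_simp

end Siegel

theorem theorem3p7 (Z Z' : ℂ × ℂ) (hZ : Z ∈ Siegel.domain) (hZ' : Z' ∈ Siegel.domain)
    (hne : Z ≠ Z') :
    -- the defining integral converges absolutely for every complex `s`
    (∀ s : ℂ, Integrable (Siegel.phiIntegrand Z Z' s) Siegel.boundaryMeasure) ∧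
    -- the closed form, and its form through the Green function, wherever every factor is defined
    (∀ s : ℂ, (∀ n : ℤ, 2 * s ≠ n) →
      Siegel.phi Z Z' s
          = Siegel.term (Siegel.u Z Z') s + Siegel.term (Siegel.u Z Z') (2 - s) ∧
      Siegel.phi Z Z' s
          = -((Real.pi : ℂ) / (s - 1)) * Siegel.cFun s * Siegel.cFun (2 - s) *
              (Siegel.green Z Z' s - Siegel.green Z Z' (2 - s))) ∧
    -- at the remaining points the singularity of the closed form is removable, with value `φ`
    (∀ s₀ : ℂ, Tendsto
      (fun s => Siegel.term (Siegel.u Z Z') s + Siegel.term (Siegel.u Z Z') (2 - s))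
      (𝓝[≠] s₀) (𝓝 (Siegel.phi Z Z' s₀))) := by
  have hu := Siegel.u_pos hZ hZ' hne
  have key (s : ℂ) (hs : s ∈ Hypergeometric.regularSet) : Siegel.phi Z Z' s =
      Siegel.term (Siegel.u Z Z') s + Siegel.term (Siegel.u Z Z') (2 - s) := by
    rw [Siegel.phi_eq_hypergeometric hZ hZ', Siegel.term_add_term hu hs, Siegel.sigma_eq]
  refine ⟨Siegel.integrable_phiIntegrand hZ hZ', fun s hs => ⟨key s hs, ?_⟩, fun s₀ => ?_⟩
  -- The product c(s) c(2 - s) is symmetric while s - 1 changes sign under s ↦ 2 - s, hence the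
  -- difference of Green functions.
  · rw [key s hs, Siegel.term_eq_green Z Z' hs,
      Siegel.term_eq_green Z Z' (Hypergeometric.two_mul_two_sub_ne hs), sub_sub_cancel,
      show 2 - s - 1 = -(s - 1) by ring, div_neg]
    ring
  · have hσ := Siegel.sigma_pos hZ hZ'
    have hξ : (((Siegel.sigma Z Z')⁻¹ : ℝ) : ℂ) ≠ 0 := Complex.ofReal_ne_zero.2 (by positivity)
    have hx : ‖1 - (((Siegel.sigma Z Z')⁻¹ : ℝ) : ℂ)‖ < 1 := by
      have h0 : 0 < (Siegel.sigma Z Z')⁻¹ := by positivity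
      have h1 : (Siegel.sigma Z Z')⁻¹ < 1 := by
        rw [Siegel.sigma_eq]
        exact inv_lt_one_of_one_lt₀ (by linarith)
      rw [← Complex.ofReal_one, ← Complex.ofReal_sub, Complex.norm_real,
        Real.norm_of_nonneg (by linarith)]
      linarith
    -- The closed form has lower parameter 2, independent of s, so it is continuous at half-integers
    -- too.
    have hF : ContinuousAt (Siegel.phi Z Z') s₀ := by
      have h : Siegel.phi Z Z' = fun s => 2 * (Real.pi : ℂ) ^ 2 *
          ((((Siegel.sigma Z Z')⁻¹ : ℝ) : ℂ) ^ s *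
            ordinaryHypergeometric s s 2 (1 - (((Siegel.sigma Z Z')⁻¹ : ℝ) : ℂ))) :=
        funext fun s => Siegel.phi_eq_hypergeometric hZ hZ' s
      rw [h]
      refine continuousAt_const.mul (ContinuousAt.mul ?_ ?_)
      · exact continuousAt_id.const_cpow (Or.inl hξ)
      · exact (Hypergeometric.differentiableAt_parameters differentiable_id differentiable_id
          (differentiable_const 2) hx Hypergeometric.two_ne_neg_natCast).continuousAt
    refine (hF.tendsto.mono_left nhdsWithin_le_nhds).congr' ?_
    filter_upwards [Hypergeometric.eventually_mem_regularSet s₀] with s hs using key s hs
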